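/- **Theorem 2 (Young Diagram Classification).** Let $C\in\mathbb C$. Let $\widehat{\mathrm{gl}}(\infty)$ be generated by $E(i,j)$, $i,j\in\mathbb Z$, with central charge $C$ and relations $$[E(i,j),E(k,\ell)]=\delta_{j+k,0}E(i,\ell)-\delta_{i+\ell,0}E(k,j)+C\,\delta_{j+k,0}\,\delta_{i+\ell,0}\,(\theta(i)-\theta(k)),$$ where $\theta(i)=1$ for $i\ge 0$ and $\theta(i)=0$ for $i<0$. Consider the generalized Verma module generated by a vector $|\lambda\rangle$ subject to $E(i,j)|\lambda\rangle=0$ whenever $i\ge 0$ or $j>0$, so that it is freely generated by the commuting operators $E(-i,-j)$, $i\ge1$, $j\ge0$. (This is the $\widehat{\mathrm{gl}}(\infty)$ form of the generalized Verma module of $W_{1+\infty}$ with $K=1$, $b(w)=w-\lambda$ and $\Delta(x)=C\frac{e^{\lambda x}-1}{e^x-1}$.) It carries a unique bilinear form $\langle\cdot|\cdot\rangle$ (and, if $C$ is real, a unique sesquilinear form) with $\langle\lambda|\lambda\rangle=1$ and $E(i,j)^\dagger=E(-j,-i)$; either of them is meant below. Let $n\ge0$, let $i_1,\dots,i_n$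 be distinct positive integers and $j_1,\dots,j_n$ distinct non-negative integers. For every Young diagram $Y$ with $n$ boxes let $D^Y$ be a real orthogonal matrix form, of size $d_Y$, of the irreducible representation of $S_n$ labelled by $Y$ (a single row being the trivial representation), and let $$|Y;\alpha\beta\rangle=\frac{d_Y}{n!}\sum_{\sigma\in S_n}D^Y(\sigma)_{\alpha\beta}\prod_{a=1}^nE(-i_a,-j_{\sigma(a)})|\lambda\rangle ,\qquad 1\le\alpha,\beta\le d_Y .$$ Then the vectors $|Y;\alpha\beta\rangle$ form a basis of the span of the vectors $\prod_{a=1}^nE(-i_a,-j_{\sigma(a)})|\lambda\rangle$, $\sigma\in S_n$, and this basis is orthogonal: $$\langle Y;\alpha\beta|Y';\mu\nu\rangle=\delta_{YY'}\delta_{\alpha\mu}\delta_{\beta\nu}\,a_n^Y,\qquad a_n^Y=\frac{d_Y}{n!}\prod_{b\in Y}(C-C_b),$$ where $C_b$ is the content (column index minus row index) of the box $b$. Moreover, with the sum over cycle types $(k)=1^{k_1}2^{k_2}\cdots n^{k_n}$ of $S_n$, $L(k)=\sum_jk_j$, $N(k)=n!/\prod_j j^{k_j}k_j!$, and $\chi_Y(k)$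 the value of the character of $Y$ on the class $(k)$, $$\frac{(-1)^n}{n!}\sum_{(k)}(-C)^{L(k)}N(k)\chi_Y(k)=\frac{d_Y}{n!}\prod_{b\in Y}(C-C_b).$$ -/

import Mathlib

/-! ## The algebra `ĝl(∞)` at central charge `C` and its generalized Verma module -/

/-- The step function: `θ(i) = 1` for `i ≥ 0` and `θ(i) = 0` for `i < 0`. -/
def stepFn (i : ℤ) : ℂ := if 0 ≤ i then 1 else 0

/-- The commutation relations of `ĝl(∞)` with central charge `C`,
`[E(i,j), E(k,l)] = δ_{j+k,0} E(i,l) - δ_{i+l,0} E(k,j) + C δ_{j+k,0} δ_{i+l,0} (θ(i) - θ(k))`,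
as relations on the free associative algebra on the symbols `E(i,j)`, `i, j ∈ ℤ`. -/
inductive GlRel (C : ℂ) : FreeAlgebra ℂ (ℤ × ℤ) → FreeAlgebra ℂ (ℤ × ℤ) → Prop
  | comm (i j k l : ℤ) : GlRel C
      (FreeAlgebra.ι ℂ (i, j) * FreeAlgebra.ι ℂ (k, l)
        - FreeAlgebra.ι ℂ (k, l) * FreeAlgebra.ι ℂ (i, j))
      ((if j + k = 0 then FreeAlgebra.ι ℂ (i, l) else 0)
        - (if i + l = 0 then FreeAlgebra.ι ℂ (k, j) else 0)
        + algebraMap ℂ _ (if j + k = 0 ∧ i + l = 0 then C * (stepFn i - stepFn k) else 0))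

/-- The enveloping algebra of `ĝl(∞)` in which the central element acts as the number `C`:
the associative algebra generated by the `E(i,j)` with the commutation relations above. -/
abbrev GlHat (C : ℂ) : Type := RingQuot (GlRel C)

/-- The generator `E(i,j)`. -/
noncomputable def genE (C : ℂ) (i j : ℤ) : GlHat C :=
  RingQuot.mkAlgHom ℂ (GlRel C) (FreeAlgebra.ι ℂ (i, j))

/-- The left ideal annihilating the highest weight state `|λ⟩`: all `E(i,j)` with `i ≥ 0` or
`j > 0` kill `|λ⟩`. This contains the highest weight conditions (`E(i,j)|λ⟩ = 0` for `i + j > 0`,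
and `E(i,-i)|λ⟩ = q_i |λ⟩` with `q_i = C θ(i) - C θ(i) = 0`) and the null generators for
`b(w) = w - λ`. The generators that are left are the `E(-i,-j)` with `i ≥ 1`, `j ≥ 0`. -/
noncomputable def vacuumIdeal (C : ℂ) : Ideal (GlHat C) :=
  Ideal.span {x | ∃ i j : ℤ, (0 ≤ i ∨ 0 < j) ∧ x = genE C i j}

/-- The generalized Verma module. -/
abbrev VermaModule (C : ℂ) : Type := GlHat C ⧸ vacuumIdeal C

/-- The highest weight state `|λ⟩`. -/
noncomputable def vac (C : ℂ) : VermaModule C := Submodule.Quotient.mk 1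

/-- The inner product of the module: the form that is `ℂ`-linear in the second argument,
`τ`-semilinear in the first one, for which `E(-i,-j)† = E(j,i)`, and with `⟨λ|λ⟩ = 1`. -/
def IsInnerForm (C : ℂ) (τ : ℂ →+* ℂ)
    (B : VermaModule C →ₛₗ[τ] VermaModule C →ₗ[ℂ] ℂ) : Prop :=
  B (vac C) (vac C) = 1 ∧
  ∀ (i j : ℤ) (u v : VermaModule C), B (genE C i j • u) v = B u (genE C (-j) (-i) • v)

/-- The state `∏_a E(-i_a, -j_{σ(a)}) |λ⟩`. -/
noncomputable def permState (C : ℂ) {n : ℕ} (i j : Fin n → ℤ) (σ : Equiv.Perm (Fin n)) :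
    VermaModule C :=
  (List.ofFn fun a => genE C (-(i a)) (-(j (σ a)))).prod • vac C

/-! ## Irreducible representations of the symmetric group -/

/-- Row symmetrizer of a filling `T` of `Y` by `0, …, n-1`. -/
noncomputable def rowSymmetrizer {n : ℕ} {Y : YoungDiagram} (T : Fin n ≃ Y.cells) :
    MonoidAlgebra ℝ (Equiv.Perm (Fin n)) :=
  ∑ σ : Equiv.Perm (Fin n),
    if ∀ a, (T (σ a)).1.1 = (T a).1.1 then MonoidAlgebra.single σ (1 : ℝ) else 0

/-- Column antisymmetrizer of a filling `T` of `Y` by `0, …, n-1`. -/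
noncomputable def colAntisymmetrizer {n : ℕ} {Y : YoungDiagram} (T : Fin n ≃ Y.cells) :
    MonoidAlgebra ℝ (Equiv.Perm (Fin n)) :=
  ∑ σ : Equiv.Perm (Fin n),
    if ∀ a, (T (σ a)).1.2 = (T a).1.2 then
      MonoidAlgebra.single σ (((Equiv.Perm.sign σ : ℤˣ) : ℤ) : ℝ) else 0

/-- The Specht module of `Y`: the left ideal of the group algebra generated by the
Young symmetrizer of a filling `T` of `Y`. -/
noncomputable def spechtModule {n : ℕ} {Y : YoungDiagram} (T : Fin n ≃ Y.cells) :
    Ideal (MonoidAlgebra ℝ (Equiv.Perm (Fin n))) :=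
  Ideal.span {rowSymmetrizer T * colAntisymmetrizer T}

/-- A real orthogonal matrix form `D^Y` of the irreducible representation of `S_n` with Young
diagram `Y`; its size is `d = d_Y`. -/
structure YoungRep (n : ℕ) (Y : YoungDiagram) where
  /-- the dimension `d_Y` -/
  d : ℕ
  /-- the matrices `D^Y(σ)` -/
  D : Equiv.Perm (Fin n) →* Matrix (Fin d) (Fin d) ℝ
  orthogonal : ∀ σ, D σ * (D σ).transpose = 1
  affords : ∃ (T : Fin n ≃ Y.cells) (P : (Fin d → ℝ) ≃ₗ[ℝ] spechtModule T),
    ∀ σ v, (P ((D σ).mulVec v) : MonoidAlgebra ℝ (Equiv.Perm (Fin n)))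
      = MonoidAlgebra.single σ 1 * (P v : MonoidAlgebra ℝ (Equiv.Perm (Fin n)))

/-- The Young diagrams with `n` boxes. -/
abbrev DiagramOfSize (n : ℕ) : Type := {Y : YoungDiagram // Y.card = n}

/-- The vector `|Y;αβ⟩ = B^Y_{αβ} ∏_a E(-i_a,-j_a)|λ⟩`, where
`B^Y_{αβ} = (d_Y / n!) ∑_σ D^Y(σ)_{αβ} σ` and `σ` sends `∏_a E(-i_a,-j_a)|λ⟩` to
`∏_a E(-i_a,-j_{σ(a)})|λ⟩`. -/
noncomputable def youngKet (C : ℂ) {n : ℕ} (i j : Fin n → ℤ) {Y : YoungDiagram}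
    (R : YoungRep n Y) (α β : Fin R.d) : VermaModule C :=
  ((R.d : ℂ) / (n.factorial : ℂ)) •
    ∑ σ : Equiv.Perm (Fin n), ((R.D σ α β : ℝ) : ℂ) • permState C i j σ

/-- The content product `∏_{b ∈ Y} (C - C_b)`, `C_b` = column index minus row index of `b`. -/
noncomputable def contentProd (C : ℂ) (Y : YoungDiagram) : ℂ :=
  ∏ b ∈ Y.cells, (C - ((b.2 : ℂ) - (b.1 : ℂ)))

/-- The size `N(k) = n! / ∏_j (j^{k_j} k_j!)` of the conjugacy class of cycle type
`(k) = 1^{k_1} 2^{k_2} ⋯ n^{k_n}`, where `k_j` is the multiplicity of `j` in the partition. -/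
noncomputable def classSize {n : ℕ} (k : n.Partition) : ℂ :=
  (n.factorial : ℂ) /
    ∏ j ∈ Finset.Icc 1 n, ((j : ℂ) ^ (k.parts.count j) * ((k.parts.count j).factorial : ℂ))

/-! ## A representation by first-order differential operators -/

/-! The module is realised on polynomials in the entries of a generic matrix `X`. The generator
`E(i,j)` acts by a vector field of fractional-linear type plus, for `i < 0` and `j ≤ 0`,
multiplication by `C X(i,j)` (`glOp`). The polynomial 1 is a vacuum vector, and the constant term is
a vacuum for the adjoint action. Hence `u|λ⟩ ↦ u·1` and `u|λ⟩ ↦ (g ↦ constant term of u†g)` are well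
defined, and pairing them gives the form (`vermaForm`). It is unique because words in the raising
operators span the module and every nonempty word is orthogonal to the vacuum.

The Gram matrix of the permuted states comes from building permutations one point at a time. A
further raising operator either multiplies a monomial by `C X`, which adds a fixed point, or
differentiates it, which inserts the new index into an existing cycle with a factor -1
(`glRep_list_prod`). The adjoints of the raising operators are partial derivatives and read off
coefficients of monomials. So `⟨σ|ρ⟩ = sgn(ρ⁻¹σ) C^cyc(ρ⁻¹σ)` (`vermaForm_permState`): the Gram
matrix is convolution by a class function, hence a scalar on every Specht module.

To find this scalar, let the class function act on the Young symmetrizer and compare coefficients of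
the identity. What results is the sum of `sgn(p) C^cyc(pq)` over row permutations `p` and column
permutations `q`. Removing a corner box `n` splits off a factor: with `p = p'(x n)` and `q = (y
n)q'`, the term `x = y = n` contributes `C`, each other box of the row of `n` contributes -1, each
other box of its column +1, and the terms with both transpositions nontrivial cancel
(`rowColSum_insert`). The factor is `C` minus the content of `n`, and induction gives the content
product.

Orthogonality of matrix coefficients follows from Schur's lemma, which is deduced from the
row-column combinatorics of fillings: the Young symmetrizer is a multiple of an idempotent `e` with
`e A e = ℝ e`. The vectors span because the characters are linearly independent and there are at
least as many diagrams as conjugacy classes. The trace of the Gram operator, grouped by cycle type,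
is the character formula. -/

/-- Entries of the generic matrix `X`, extended to the rows `i ≥ 0` by the unit matrix. -/
noncomputable def rowEntry (i l : ℤ) : MvPolynomial (ℤ × ℤ) ℂ :=
  if i < 0 then MvPolynomial.X (i, l) else if i + l = 0 then 1 else 0

/-- Entries of the generic matrix `X`, extended to the columns `j > 0` by minus the unit matrix. -/
noncomputable def colEntry (k j : ℤ) : MvPolynomial (ℤ × ℤ) ℂ :=
  if j ≤ 0 then MvPolynomial.X (k, j) else if j + k = 0 then -1 else 0

/-- The vector field by which `E(i,j)` acts on the generic matrix. -/
noncomputable def glDer (i j : ℤ) :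
    Derivation ℂ (MvPolynomial (ℤ × ℤ) ℂ) (MvPolynomial (ℤ × ℤ) ℂ) :=
  MvPolynomial.mkDerivation ℂ fun p => -(rowEntry i p.2 * colEntry p.1 j)

/-- The multiplication part of the action of `E(i,j)`. -/
noncomputable def glShift (C : ℂ) (i j : ℤ) : MvPolynomial (ℤ × ℤ) ℂ :=
  if i < 0 ∧ j ≤ 0 then C • MvPolynomial.X (i, j) else 0

/-- The first-order operator by which `E(i,j)` acts on polynomials. -/
noncomputable def glOp (C : ℂ) (i j : ℤ) : Module.End ℂ (MvPolynomial (ℤ × ℤ) ℂ) :=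
  (glDer i j).toLinearMap + LinearMap.mulLeft ℂ (glShift C i j)

lemma glOp_apply (C : ℂ) (i j : ℤ) (g : MvPolynomial (ℤ × ℤ) ℂ) :
    glOp C i j g = glDer i j g + glShift C i j * g := rfl

lemma glDer_X (i j k l : ℤ) :
    glDer i j (MvPolynomial.X (k, l)) = -(rowEntry i l * colEntry k j) := by
  simp [glDer, MvPolynomial.mkDerivation_X]

lemma glDer_rowEntry (i j k l : ℤ) :
    glDer i j (rowEntry k l) = if k < 0 then -(rowEntry i l * colEntry k j) else 0 := by
  rw [rowEntry]
  split_ifs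
  · exact glDer_X ..
  · exact Derivation.map_one_eq_zero _
  · exact map_zero _

lemma glDer_colEntry (i j k l : ℤ) :
    glDer i j (colEntry k l) = if l ≤ 0 then -(rowEntry i l * colEntry k j) else 0 := by
  rw [colEntry]
  split_ifs
  · exact glDer_X ..
  · rw [map_neg, Derivation.map_one_eq_zero, neg_zero]
  · exact map_zero _

/-- For `k < 0` and `j ≤ 0` both terms are the same variable and cancel; otherwise only a Kronecker
delta is left. This is what turns the cubic terms in the commutator of two vector fields into a
combination of vector fields. -/
lemma entry_cancel (j k : ℤ) :
    (if k < 0 then colEntry k j else 0) - (if j ≤ 0 then rowEntry k j else 0)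
      = if j + k = 0 then -1 else 0 := by
  unfold rowEntry colEntry
  have : k + j = j + k := add_comm _ _
  split_ifs <;> first | omega | simp

lemma glDer_comm (i j k m : ℤ) :
    ⁅glDer i j, glDer k m⁆
      = (if j + k = 0 then glDer i m else 0) - (if i + m = 0 then glDer k j else 0) := by
  refine MvPolynomial.derivation_ext fun ⟨r, s⟩ => ?_
  have h1 := entry_cancel j k
  have h2 := entry_cancel m i
  have e1 : (if j + k = 0 then glDer i m else 0) (MvPolynomial.X (r, s))
      = (if j + k = 0 then -1 else 0) * (rowEntry i s * colEntry r m) := by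
    split_ifs <;> simp [glDer_X]
  have e2 : (if i + m = 0 then glDer k j else 0) (MvPolynomial.X (r, s))
      = (if m + i = 0 then -1 else 0) * (rowEntry k s * colEntry r j) := by
    rw [add_comm m i]
    split_ifs <;> simp [glDer_X]
  rw [Derivation.commutator_apply, Derivation.sub_apply, e1, e2, ← h1, ← h2]
  simp only [glDer_X, map_neg, Derivation.leibniz, smul_eq_mul, glDer_rowEntry, glDer_colEntry]
  split_ifs <;> ring

/-- The multiplication part must be a one-cocycle for the vector fields up to constants. The central
term arises when a constant vector field (`i ≥ 0`, `j > 0`) differentiates the linear function `C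
X(k,m)`, or with the two roles exchanged. -/
lemma glShift_comm (C : ℂ) (i j k m : ℤ) :
    glDer i j (glShift C k m) - glDer k m (glShift C i j)
      = (if j + k = 0 then glShift C i m else 0) - (if i + m = 0 then glShift C k j else 0)
        + MvPolynomial.C
          (if j + k = 0 ∧ i + m = 0 then C * (stepFn i - stepFn k) else 0) := by
  have key : ∀ a b c d : ℤ, glDer a b (glShift C c d)
      = C • (if c < 0 ∧ d ≤ 0 then -(rowEntry a d * colEntry c b) else 0) := by
    intro a b c d
    unfold glShift
    split_ifs
    · rw [Derivation.map_smul, glDer_X]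
    · simp
  have hs : ∀ c d : ℤ, glShift C c d
      = C • (if c < 0 ∧ d ≤ 0 then MvPolynomial.X (c, d) else 0) := by
    intro c d; unfold glShift; split_ifs <;> simp
  have hC : MvPolynomial.C (σ := ℤ × ℤ)
      (if j + k = 0 ∧ i + m = 0 then C * (stepFn i - stepFn k) else 0)
      = C • (if j + k = 0 ∧ i + m = 0 then
          ((if 0 ≤ i then 1 else 0) - (if 0 ≤ k then 1 else 0)) else 0) := by
    unfold stepFn
    split_ifs <;> simp [MvPolynomial.smul_eq_C_mul]
  rw [key, key, hC, hs i m, hs k j]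
  have hl : ∀ (p : Prop) [Decidable p] (x : MvPolynomial (ℤ × ℤ) ℂ),
      (if p then C • x else 0) = C • (if p then x else 0) := by
    intro p _ x; split_ifs <;> simp
  rw [hl, hl, ← smul_sub, ← smul_sub, ← smul_add]
  congr 1
  unfold rowEntry colEntry
  have e1 : k + j = j + k := add_comm _ _
  have e2 : m + i = i + m := add_comm _ _
  have i' : 0 ≤ i ↔ ¬ i < 0 := not_lt.symm
  have k' : 0 ≤ k ↔ ¬ k < 0 := not_lt.symm
  by_cases hi : i < 0 <;> by_cases hk : k < 0 <;> by_cases hj : j ≤ 0 <;> by_cases hm : m ≤ 0 <;>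
    simp only [hi, hk, hj, hm, i', k', e1, e2, and_self, and_true, and_false, if_true, if_false,
      not_true, not_false_eq_true] <;>
    by_cases hjk : j + k = 0 <;> by_cases him : i + m = 0 <;>
    first
    | (exfalso; omega)
    | (simp only [hjk, him, and_self, and_true, and_false, if_true, if_false]; ring)

lemma glOp_comm (C : ℂ) (i j k m : ℤ) :
    glOp C i j * glOp C k m - glOp C k m * glOp C i j
      = (if j + k = 0 then glOp C i m else 0) - (if i + m = 0 then glOp C k j else 0)
        + algebraMap ℂ _ (if j + k = 0 ∧ i + m = 0 then C * (stepFn i - stepFn k) else 0) := by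
  have h1 := glDer_comm i j k m
  have h2 := glShift_comm C i j k m
  refine LinearMap.ext fun g => ?_
  have h1' := congrArg (fun D => D g) h1
  simp only [Derivation.commutator_apply, Derivation.sub_apply] at h1'
  have e : ∀ (p : Prop) [Decidable p] (a b : ℤ), (if p then glOp C a b else 0) g
      = (if p then glDer a b else 0) g + (if p then glShift C a b else 0) * g := by
    intro p _ a b
    split_ifs
    · exact glOp_apply ..
    · simp
  simp only [LinearMap.add_apply, LinearMap.sub_apply, Module.End.mul_apply, e, glOp_apply,
    Module.algebraMap_end_apply, map_add, Derivation.leibniz, smul_eq_mul]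
  rw [MvPolynomial.smul_eq_C_mul]
  linear_combination h1' + g * h2

/-- The representation of `ĝl(∞)` by first-order differential operators. -/
noncomputable def glRep (C : ℂ) : GlHat C →ₐ[ℂ] Module.End ℂ (MvPolynomial (ℤ × ℤ) ℂ) :=
  RingQuot.liftAlgHom ℂ ⟨FreeAlgebra.lift ℂ fun p : ℤ × ℤ => glOp C p.1 p.2, by
    rintro _ _ ⟨i, j, k, l⟩
    have e : ∀ (p : Prop) [Decidable p] (x : FreeAlgebra ℂ (ℤ × ℤ)),
        FreeAlgebra.lift ℂ (fun p : ℤ × ℤ => glOp C p.1 p.2) (if p then x else 0)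
          = if p then FreeAlgebra.lift ℂ (fun p : ℤ × ℤ => glOp C p.1 p.2) x else 0 := by
      intro p _ x; split_ifs <;> simp
    simpa only [map_sub, map_mul, map_add, AlgHom.commutes, e, FreeAlgebra.lift_ι_apply]
      using glOp_comm C i j k l⟩

lemma glRep_genE (C : ℂ) (i j : ℤ) : glRep C (genE C i j) = glOp C i j := by
  simp [glRep, genE]

/-! ### The adjoint action; twisting the scalars makes a semilinear anti-homomorphism an algebra
map. -/

/-- A complex algebra whose scalar action is twisted by `τ`. -/
def TwistedAlgebra (_ : ℂ →+* ℂ) (A : Type*) : Type _ := A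

namespace TwistedAlgebra

variable {A : Type*} [Ring A] [Algebra ℂ A] (τ : ℂ →+* ℂ)

instance : Ring (TwistedAlgebra τ A) := inferInstanceAs (Ring A)

noncomputable instance : Algebra ℂ (TwistedAlgebra τ A) :=
  RingHom.toAlgebra' ((algebraMap ℂ A).comp τ) fun _ _ => Algebra.commutes (A := A) _ _

/-- The identity map onto the twisted algebra. -/
def equiv : A ≃+* TwistedAlgebra τ A := RingEquiv.refl A

lemma algebraMap_apply (c : ℂ) :
    algebraMap ℂ (TwistedAlgebra τ A) c = equiv τ (algebraMap ℂ A (τ c)) := rfl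

end TwistedAlgebra

/-- The anti-representation `E(i,j) ↦ E(i,j)†`, `τ`-semilinear. -/
noncomputable def glAdj (C : ℂ) (τ : ℂ →+* ℂ) (hτ : τ C = C) :
    GlHat C →ₐ[ℂ] TwistedAlgebra τ (Module.End ℂ (MvPolynomial (ℤ × ℤ) ℂ))ᵐᵒᵖ :=
  RingQuot.liftAlgHom ℂ ⟨FreeAlgebra.lift ℂ fun p : ℤ × ℤ =>
      TwistedAlgebra.equiv τ (MulOpposite.op (glOp C (-p.2) (-p.1))), by
    rintro _ _ ⟨i, j, k, l⟩
    have e : ∀ (p : Prop) [Decidable p] (x : FreeAlgebra ℂ (ℤ × ℤ)) (f : FreeAlgebra ℂ (ℤ × ℤ) →ₐ[ℂ]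
        TwistedAlgebra τ (Module.End ℂ (MvPolynomial (ℤ × ℤ) ℂ))ᵐᵒᵖ),
        f (if p then x else 0) = if p then f x else 0 := by
      intro p _ x f; split_ifs <;> simp
    have e' : ∀ (p : Prop) [Decidable p] (x : Module.End ℂ (MvPolynomial (ℤ × ℤ) ℂ)),
        (if p then TwistedAlgebra.equiv τ (MulOpposite.op x) else 0)
          = TwistedAlgebra.equiv τ (MulOpposite.op (if p then x else 0)) := by
      intro p _ x; split_ifs <;> simp
    simp only [map_sub, map_mul, map_add, AlgHom.commutes, e, FreeAlgebra.lift_ι_apply, e',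
      TwistedAlgebra.algebraMap_apply]
    rw [← map_mul, ← map_mul, ← map_sub, ← map_sub, ← map_add]
    congr 1
    rw [MulOpposite.algebraMap_apply, ← MulOpposite.op_mul, ← MulOpposite.op_mul,
      ← MulOpposite.op_sub, ← MulOpposite.op_sub, ← MulOpposite.op_add, glOp_comm]
    have h1 : -k + -j = 0 ↔ j + k = 0 := by omega
    have h2 : -l + -i = 0 ↔ i + l = 0 := by omega
    simp only [h1, h2]
    congr 3
    split_ifs with h
    -- The central term is the only place where `C` occurs, so the adjoint is compatible with the
    -- relations once `τ` fixes `C`.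
    · rw [show -l = i by omega, show -j = k by omega, map_mul, hτ]
      unfold stepFn
      split_ifs <;> simp
    · simp⟩

lemma glAdj_genE (C : ℂ) (τ : ℂ →+* ℂ) (hτ : τ C = C) (i j : ℤ) :
    glAdj C τ hτ (genE C i j)
      = TwistedAlgebra.equiv τ (MulOpposite.op (glOp C (-j) (-i))) := by
  simp [glAdj, genE]

/-- These vector fields vanish at the origin `X = 0`: each of their coefficients contains a variable
as a factor. -/
lemma glDer_constantCoeff {i j : ℤ} (h : i < 0 ∨ j ≤ 0) (g : MvPolynomial (ℤ × ℤ) ℂ) :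
    MvPolynomial.constantCoeff (glDer i j g) = 0 := by
  induction g using MvPolynomial.induction_on with
  | C a => simp
  | add p q hp hq => simp [hp, hq]
  | mul_X p x hp =>
    have : MvPolynomial.constantCoeff (glDer i j (MvPolynomial.X x)) = 0 := by
      obtain ⟨k, l⟩ := x
      rw [glDer_X]
      rcases h with h | h
      · simp [rowEntry, h]
      · simp [colEntry, h]
    simp [hp, this]

lemma glOp_constantCoeff (C : ℂ) {i j : ℤ} (h : i < 0 ∨ j ≤ 0) (g : MvPolynomial (ℤ × ℤ) ℂ) :
    MvPolynomial.constantCoeff (glOp C i j g) = 0 := by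
  rw [glOp_apply, map_add, glDer_constantCoeff h, map_mul]
  unfold glShift
  split_ifs <;> simp [MvPolynomial.smul_eq_C_mul]

lemma glOp_one (C : ℂ) {i j : ℤ} (h : 0 ≤ i ∨ 0 < j) : glOp C i j 1 = 0 := by
  rw [glOp_apply, Derivation.map_one_eq_zero, glShift, if_neg (by omega)]
  simp

/-! ### States as polynomials, states as functionals, and their pairing. -/

/-- The image of a state of the Verma module in the polynomials. -/
noncomputable def vermaToPoly (C : ℂ) : VermaModule C →ₗ[ℂ] MvPolynomial (ℤ × ℤ) ℂ :=
  ((vacuumIdeal C).restrictScalars ℂ).liftQ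
    ((LinearMap.applyₗ (1 : MvPolynomial (ℤ × ℤ) ℂ)).comp (glRep C).toLinearMap) (by
      intro x hx
      rw [Submodule.restrictScalars_mem] at hx
      induction hx using Submodule.span_induction with
      | mem x hx =>
        obtain ⟨i, j, h, rfl⟩ := hx
        simp [glRep_genE, glOp_one C h]
      | zero => simp
      | add x y _ _ hx hy => exact add_mem hx hy
      | smul a x _ hx =>
        simp only [LinearMap.mem_ker, LinearMap.comp_apply, AlgHom.toLinearMap_apply,
          LinearMap.applyₗ_apply_apply] at hx ⊢
        simp [hx])

lemma vermaToPoly_mk (C : ℂ) (u : GlHat C) :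
    vermaToPoly C (Submodule.Quotient.mk u) = glRep C u 1 := rfl

lemma vermaToPoly_smul (C : ℂ) (u : GlHat C) (v : VermaModule C) :
    vermaToPoly C (u • v) = glRep C u (vermaToPoly C v) := by
  obtain ⟨w, rfl⟩ := Submodule.Quotient.mk_surjective _ v
  rw [← Submodule.Quotient.mk_smul, vermaToPoly_mk, vermaToPoly_mk, smul_eq_mul, map_mul,
    Module.End.mul_apply]

lemma vermaToPoly_vac (C : ℂ) : vermaToPoly C (vac C) = 1 := by
  rw [vac, vermaToPoly_mk, map_one (glRep C), Module.End.one_apply]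

/-- The functional on polynomials defined by a state of the Verma module. -/
noncomputable def vermaToDual (C : ℂ) (τ : ℂ →+* ℂ) (hτ : τ C = C) :
    VermaModule C →ₛₗ[τ] MvPolynomial (ℤ × ℤ) ℂ →ₗ[ℂ] ℂ :=
  ((vacuumIdeal C).restrictScalars ℂ).liftQ
    ({ toFun := fun u => (MvPolynomial.lcoeff ℂ 0).comp
          ((TwistedAlgebra.equiv τ).symm (glAdj C τ hτ u)).unop
       map_add' := fun u v => by simp [LinearMap.comp_add]
       map_smul' := fun c u => by
        rw [Algebra.smul_def, map_mul, AlgHom.commutes, TwistedAlgebra.algebraMap_apply, map_mul,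
          RingEquiv.symm_apply_apply]
        refine LinearMap.ext fun g => ?_
        simp } : GlHat C →ₛₗ[τ] MvPolynomial (ℤ × ℤ) ℂ →ₗ[ℂ] ℂ) (by
      intro x hx
      rw [Submodule.restrictScalars_mem] at hx
      induction hx using Submodule.span_induction with
      | mem x hx =>
        obtain ⟨i, j, h, rfl⟩ := hx
        refine LinearMap.ext fun g => ?_
        simpa [glAdj_genE, MvPolynomial.constantCoeff_eq]
          using glOp_constantCoeff C (by omega : -j < 0 ∨ -i ≤ 0) g
      | zero => simp
      | add x y _ _ hx hy => exact add_mem hx hy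
      | smul a x _ hx =>
        rw [LinearMap.mem_ker] at hx ⊢
        refine LinearMap.ext fun g => ?_
        have := LinearMap.congr_fun hx (((TwistedAlgebra.equiv τ).symm (glAdj C τ hτ a)).unop g)
        simpa using this)

lemma vermaToDual_vac (C : ℂ) (τ : ℂ →+* ℂ) (hτ : τ C = C) (g : MvPolynomial (ℤ × ℤ) ℂ) :
    vermaToDual C τ hτ (vac C) g = MvPolynomial.constantCoeff g := by
  change MvPolynomial.lcoeff ℂ 0 (((TwistedAlgebra.equiv τ).symm (glAdj C τ hτ 1)).unop g) = _
  rw [map_one (glAdj C τ hτ), map_one, MulOpposite.unop_one]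
  rfl

lemma vermaToDual_smul (C : ℂ) (τ : ℂ →+* ℂ) (hτ : τ C = C) (i j : ℤ) (v : VermaModule C)
    (g : MvPolynomial (ℤ × ℤ) ℂ) :
    vermaToDual C τ hτ (genE C i j • v) g = vermaToDual C τ hτ v (glOp C (-j) (-i) g) := by
  obtain ⟨w, rfl⟩ := Submodule.Quotient.mk_surjective _ v
  change MvPolynomial.lcoeff ℂ 0
      (((TwistedAlgebra.equiv τ).symm (glAdj C τ hτ (genE C i j * w))).unop g)
    = MvPolynomial.lcoeff ℂ 0 (((TwistedAlgebra.equiv τ).symm (glAdj C τ hτ w)).unop _)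
  rw [map_mul (glAdj C τ hτ), glAdj_genE, map_mul, RingEquiv.symm_apply_apply,
    MulOpposite.unop_mul]
  rfl

/-- The form on the Verma module. -/
noncomputable def vermaForm (C : ℂ) (τ : ℂ →+* ℂ) (hτ : τ C = C) :
    VermaModule C →ₛₗ[τ] VermaModule C →ₗ[ℂ] ℂ :=
  (LinearMap.lcomp ℂ ℂ (vermaToPoly C)).comp (vermaToDual C τ hτ)

lemma vermaForm_apply (C : ℂ) (τ : ℂ →+* ℂ) (hτ : τ C = C) (u v : VermaModule C) :
    vermaForm C τ hτ u v = vermaToDual C τ hτ u (vermaToPoly C v) := rfl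

lemma vermaForm_isInnerForm (C : ℂ) (τ : ℂ →+* ℂ) (hτ : τ C = C) :
    IsInnerForm C τ (vermaForm C τ hτ) := by
  refine ⟨?_, fun i j u v => ?_⟩
  · rw [vermaForm_apply, vermaToPoly_vac, vermaToDual_vac, map_one]
  · rw [vermaForm_apply, vermaForm_apply, vermaToDual_smul, vermaToPoly_smul, glRep_genE]

/-! ## Uniqueness of the form -/

lemma genE_mul_genE (C : ℂ) (i j k l : ℤ) :
    genE C i j * genE C k l = genE C k l * genE C i j
      + ((if j + k = 0 then genE C i l else 0) - (if i + l = 0 then genE C k j else 0)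
        + algebraMap ℂ _ (if j + k = 0 ∧ i + l = 0 then C * (stepFn i - stepFn k) else 0)) := by
  have h := RingQuot.mkAlgHom_rel ℂ (GlRel.comm (C := C) i j k l)
  have e : ∀ (p : Prop) [Decidable p] (x : FreeAlgebra ℂ (ℤ × ℤ)),
      RingQuot.mkAlgHom ℂ (GlRel C) (if p then x else 0)
        = if p then RingQuot.mkAlgHom ℂ (GlRel C) x else 0 := by
    intro p _ x; split_ifs <;> simp
  simp only [map_sub, map_mul, map_add, AlgHom.commutes, e] at h
  exact sub_eq_iff_eq_add'.1 h

lemma genE_smul_vac (C : ℂ) {i j : ℤ} (h : 0 ≤ i ∨ 0 < j) : genE C i j • vac C = 0 := by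
  rw [vac, ← Submodule.Quotient.mk_smul, smul_eq_mul, mul_one, Submodule.Quotient.mk_eq_zero]
  exact Submodule.subset_span ⟨i, j, h, rfl⟩

/-- A subspace which contains the vacuum and is stable under the generators is everything. -/
lemma verma_eq_top {C : ℂ} (W : Submodule ℂ (VermaModule C)) (hv : vac C ∈ W)
    (hE : ∀ i j, ∀ w ∈ W, genE C i j • w ∈ W) : W = ⊤ := by
  have key : ∀ a : FreeAlgebra ℂ (ℤ × ℤ), ∀ w ∈ W, RingQuot.mkAlgHom ℂ (GlRel C) a • w ∈ W := by
    intro a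
    induction a using FreeAlgebra.induction with
    | grade0 r =>
      intro w hw
      rw [AlgHom.commutes, algebraMap_smul]
      exact W.smul_mem r hw
    | grade1 p => exact hE p.1 p.2
    | mul a b ha hb =>
      intro w hw
      rw [map_mul, mul_smul]
      exact ha _ (hb _ hw)
    | add a b ha hb =>
      intro w hw
      rw [map_add, add_smul]
      exact W.add_mem (ha _ hw) (hb _ hw)
  rw [eq_top_iff]
  intro v _
  obtain ⟨u, rfl⟩ := Submodule.Quotient.mk_surjective _ v
  obtain ⟨a, rfl⟩ := RingQuot.mkAlgHom_surjective ℂ (GlRel C) u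
  have := key a _ hv
  rwa [vac, ← Submodule.Quotient.mk_smul, smul_eq_mul, mul_one] at this

/-- The states obtained from the vacuum by the operators `E(i,j)` with `i < 0`, `j ≤ 0` span. -/
lemma verma_span_raising (C : ℂ) :
    Submodule.span ℂ {v : VermaModule C | ∃ l : List (ℤ × ℤ), (∀ p ∈ l, p.1 < 0 ∧ p.2 ≤ 0) ∧
      v = (l.map fun p => genE C p.1 p.2).prod • vac C} = ⊤ := by
  set W := Submodule.span ℂ {v : VermaModule C | ∃ l : List (ℤ × ℤ),
    (∀ p ∈ l, p.1 < 0 ∧ p.2 ≤ 0) ∧ v = (l.map fun p => genE C p.1 p.2).prod • vac C} with hW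
  have comm : ∀ (c : ℂ) (x : GlHat C) (w : VermaModule C), x • c • w = c • x • w :=
    fun c x w => smul_comm x c w
  have hr : ∀ i j, i < 0 → j ≤ 0 → ∀ w ∈ W, genE C i j • w ∈ W := by
    intro i j hi hj w hw
    induction hw using Submodule.span_induction with
    | mem v hv =>
      obtain ⟨l, hl, rfl⟩ := hv
      refine Submodule.subset_span ⟨(i, j) :: l, ?_, ?_⟩
      · simpa [hi, hj] using hl
      · rw [List.map_cons, List.prod_cons, mul_smul]
    | zero => rw [smul_zero]; exact W.zero_mem
    | add x y _ _ hx hy => rw [smul_add]; exact W.add_mem hx hy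
    | smul c x _ hx => rw [comm]; exact W.smul_mem c hx
  -- Commuting a generator past the first letter leaves generators, with other indices, acting on
  -- the shorter word; hence the induction is over all `i j` at once.
  have hl : ∀ l : List (ℤ × ℤ), (∀ p ∈ l, p.1 < 0 ∧ p.2 ≤ 0) → ∀ i j,
      genE C i j • (l.map fun p => genE C p.1 p.2).prod • vac C ∈ W := by
    intro l
    induction l with
    | nil =>
      intro _ i j
      rw [List.map_nil, List.prod_nil, one_smul]
      by_cases h : 0 ≤ i ∨ 0 < j
      · rw [genE_smul_vac C h]; exact W.zero_mem
      · exact hr i j (by omega) (by omega) _ (Submodule.subset_span ⟨[], by simp, by simp⟩)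
    | cons p l ih =>
      intro hp i j
      have hp1 := hp p List.mem_cons_self
      have ih' := ih fun q hq => hp q (List.mem_cons_of_mem _ hq)
      rw [List.map_cons, List.prod_cons, ← mul_smul, ← mul_assoc, genE_mul_genE, add_mul,
        add_mul, sub_mul, add_smul, add_smul, sub_smul, mul_assoc, mul_smul, mul_smul]
      refine W.add_mem (hr _ _ hp1.1 hp1.2 _ (ih' i j)) (W.add_mem (W.sub_mem ?_ ?_) ?_)
      · split_ifs
        · rw [mul_smul]; exact ih' _ _
        · rw [zero_mul, zero_smul]; exact W.zero_mem
      · split_ifs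
        · rw [mul_smul]; exact ih' _ _
        · rw [zero_mul, zero_smul]; exact W.zero_mem
      · rw [mul_smul, algebraMap_smul]
        exact W.smul_mem _ (Submodule.subset_span
          ⟨l, fun q hq => hp q (List.mem_cons_of_mem _ hq), rfl⟩)
  refine verma_eq_top W (Submodule.subset_span ⟨[], by simp, by simp⟩) fun i j w hw => ?_
  induction hw using Submodule.span_induction with
  | mem v hv =>
    obtain ⟨l, hl', rfl⟩ := hv
    exact hl l hl' i j
  | zero => rw [smul_zero]; exact W.zero_mem
  | add x y _ _ hx hy => rw [smul_add]; exact W.add_mem hx hy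
  | smul c x _ hx => rw [comm]; exact W.smul_mem c hx

/-- In `⟨λ|E(i,j)⋯⟩` with `E(i,j)` raising, moving this letter to the left gives an operator that
kills the vacuum. So the two forms agree when the left vector is the vacuum, and invariance
propagates this to every left vector. -/
lemma IsInnerForm.unique {C : ℂ} {τ : ℂ →+* ℂ}
    {B B' : VermaModule C →ₛₗ[τ] VermaModule C →ₗ[ℂ] ℂ}
    (h : IsInnerForm C τ B) (h' : IsInnerForm C τ B') : B = B' := by
  have hvac : B (vac C) = B' (vac C) := by
    refine LinearMap.ext_on_range (v := fun x : {v : VermaModule C // ∃ l : List (ℤ × ℤ),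
      (∀ p ∈ l, p.1 < 0 ∧ p.2 ≤ 0) ∧ v = (l.map fun p => genE C p.1 p.2).prod • vac C} => x.1)
      (by rw [Subtype.range_coe_subtype]; exact verma_span_raising C) ?_
    rintro ⟨_, l, hl, rfl⟩
    cases l with
    | nil => simp [h.1, h'.1]
    | cons p l =>
      have hp := hl p List.mem_cons_self
      have e : ∀ D : VermaModule C →ₛₗ[τ] VermaModule C →ₗ[ℂ] ℂ, IsInnerForm C τ D →
          D (vac C) (((p :: l).map fun p => genE C p.1 p.2).prod • vac C) = 0 := by
        intro D hD
        have := hD.2 (-p.2) (-p.1) (vac C) ((l.map fun p => genE C p.1 p.2).prod • vac C)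
        rw [neg_neg, neg_neg, genE_smul_vac C (by omega), map_zero, LinearMap.zero_apply,
          ← mul_smul] at this
        rw [List.map_cons, List.prod_cons, this]
      exact (e B h).trans (e B' h').symm
  have := verma_eq_top (C := C) (LinearMap.eqLocus B B') hvac fun i j w hw => by
    rw [LinearMap.mem_eqLocus] at hw ⊢
    refine LinearMap.ext fun v => ?_
    rw [h.2, h'.2, hw]
  exact LinearMap.eqLocus_eq_top.1 this

/-! ## Cycle counting -/

section Cycles

variable {α : Type*} [Fintype α] [DecidableEq α]

open Equiv Equiv.Perm

/-- The transposition inserts the fixed point `n` into the cycle of `x`. If `x` is fixed too, a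
2-cycle is created and the support grows by 2; otherwise one cycle is lengthened and the support
grows by 1. -/
lemma card_cycleType_swap_mul {g : Perm α} {x n : α} (hn : g n = n) (hx : x ≠ n) :
    Multiset.card (swap n x * g).cycleType + g.support.card + 1
      = Multiset.card g.cycleType + (swap n x * g).support.card := by
  by_cases hxg : g x = x
  · have hd : Disjoint (swap n x) g := by
      rw [disjoint_iff_disjoint_support, support_swap hx.symm, Finset.disjoint_left]
      intro y hy
      rcases Finset.mem_insert.1 hy with rfl | hy
      · simpa using hn
      · rw [Finset.mem_singleton] at hy
        subst hy
        simpa using hxg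
    rw [hd.cycleType_mul, hd.card_support_mul, Multiset.card_add, card_support_swap hx.symm,
      (isCycle_swap hx.symm).cycleType]
    simp
    omega
  · set f := g.cycleOf x with hf
    have hfc : f ∈ g.cycleFactorsFinset :=
      cycleOf_mem_cycleFactorsFinset_iff.2 (mem_support.2 hxg)
    have hd : Disjoint f (f⁻¹ * g) := by
      have h1 := disjoint_mul_inv_of_mem_cycleFactorsFinset hfc
      have h2 : Commute f g := (self_mem_cycle_factors_commute hfc)
      rw [(h2.inv_left).eq]
      exact h1.symm
    set k := f⁻¹ * g with hk
    have hg : g = f * k := by simp [hk]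
    have hfn : f n = n := by
      by_contra h
      exact (mem_support.1 (support_cycleOf_le g x (mem_support.2 h))) hn
    have hkn : k n = n := by
      rw [hk, mul_apply, hn, inv_eq_iff_eq, hfn]
    have hfx : x ∈ f.support := by
      rw [hf, mem_support, cycleOf_apply_self]; exact hxg
    obtain ⟨l, hl⟩ : ∃ l, toList g x = x :: l := by
      have h0 := toList_getElem_zero (p := g) (x := x) (mem_support.2 hxg)
      cases h : toList g x with
      | nil => exact absurd (mem_support.2 hxg) (toList_eq_nil_iff.1 h)
      | cons y l => simp only [h, List.getElem_cons_zero] at h0; exact ⟨l, by rw [h0]⟩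
    have hfl : f = (x :: l).formPerm := by rw [← hl, formPerm_toList]
    have hnd : (x :: l).Nodup := hl ▸ nodup_toList g x
    have hlen : (x :: l).length = f.support.card := by rw [← hl, length_toList]
    have hn' : n ∉ x :: l := by
      rw [← hl, mem_toList_iff]
      rintro ⟨h, _⟩
      have := (h.apply_eq_self_iff).2 hn
      exact hxg this
    have hs : swap n x * f = (n :: x :: l).formPerm := by
      rw [List.formPerm_cons_cons, hfl]
    have hnd' : (n :: x :: l).Nodup := List.nodup_cons.2 ⟨hn', hnd⟩
    have hcyc : IsCycle (swap n x * f) := by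
      rw [hs]; exact List.isCycle_formPerm hnd' (by simp)
    have hcard : (swap n x * f).support.card = f.support.card + 1 := by
      rw [hs, List.support_formPerm_of_nodup _ hnd' (by simp), List.toFinset_card_of_nodup hnd',
        List.length_cons, hlen]
    have hd' : Disjoint (swap n x * f) k := by
      intro y
      rcases hd y with h | h
      · by_cases hyn : y = n
        · right; rw [hyn, hkn]
        · left
          rw [mul_apply, h, swap_apply_of_ne_of_ne hyn]
          rintro rfl
          exact mem_support.1 hfx h
      · exact Or.inr h
    rw [hg, ← mul_assoc, hd.cycleType_mul, hd'.cycleType_mul, hd.card_support_mul,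
      hd'.card_support_mul, Multiset.card_add, Multiset.card_add, hcyc.cycleType, hcard,
      ((mem_cycleFactorsFinset_iff.1 hfc).1).cycleType]
    simp
    omega

/-- The number of cycles, fixed points included, of a permutation of a set with `m` elements. -/
def cycleCount (m : ℕ) (g : Perm α) : ℕ := Multiset.card g.cycleType + (m - g.support.card)

lemma cycleCount_eq_of_isConj (m : ℕ) {g h : Perm α} (H : IsConj g h) :
    cycleCount m g = cycleCount m h := by
  rw [isConj_iff_cycleType_eq] at H
  rw [cycleCount, cycleCount, ← sum_cycleType, ← sum_cycleType, H]

lemma cycleCount_mul_comm (m : ℕ) (g h : Perm α) :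
    cycleCount m (g * h) = cycleCount m (h * g) :=
  cycleCount_eq_of_isConj m (isConj_iff.2 ⟨h, by group⟩)

lemma cycleCount_inv (m : ℕ) (g : Perm α) : cycleCount m g⁻¹ = cycleCount m g := by
  rw [cycleCount, cycleCount, cycleType_inv, support_inv]

lemma cycleCount_one (m : ℕ) : cycleCount m (1 : Perm α) = m := by
  simp [cycleCount]

/-- The bound keeps the truncated subtraction in `cycleCount` exact. -/
lemma cycleCount_succ {m : ℕ} {g : Perm α} (h : g.support.card ≤ m) :
    cycleCount (m + 1) g = cycleCount m g + 1 := by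
  unfold cycleCount; omega

/-- The ambient set gains the point `n`, but `n` joins an existing cycle. -/
lemma cycleCount_mul_swap {m : ℕ} {g : Perm α} {x n : α} (h : g.support.card ≤ m)
    (hn : g n = n) (hx : x ≠ n) (h' : (g * swap x n).support.card ≤ m + 1) :
    cycleCount (m + 1) (g * swap x n) = cycleCount m g := by
  have hc : IsConj (g * swap x n) (swap n x * g) :=
    isConj_iff.2 ⟨swap n x, by rw [swap_comm x n]; simp [mul_assoc]⟩
  have hs : (g * swap x n).support.card = (swap n x * g).support.card := by
    rw [← sum_cycleType, ← sum_cycleType, isConj_iff_cycleType_eq.1 hc]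
  rw [cycleCount_eq_of_isConj _ hc]
  have := card_cycleType_swap_mul hn hx
  unfold cycleCount
  omega

lemma cycleCount_card_eq_card_parts (g : Perm α) :
    cycleCount (Fintype.card α) g = Multiset.card g.partition.parts := by
  rw [parts_partition, Multiset.card_add, Multiset.card_replicate, cycleCount]

/-- The sign of `g` is -1 to the number of points minus the number of cycles. -/
lemma sign_mul_pow_cycleCount (C : ℂ) (g : Perm α) :
    ((sign g : ℤ) : ℂ) * C ^ cycleCount (Fintype.card α) g
      = (-1) ^ Fintype.card α * (-C) ^ cycleCount (Fintype.card α) g := by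
  have hs : g.support.card ≤ Fintype.card α := Finset.card_le_univ _
  have h1 : ((sign g : ℤ) : ℂ) = (-1) ^ (g.support.card + Multiset.card g.cycleType) := by
    rw [sign_of_cycleType, sum_cycleType]; simp
  have h2 : Fintype.card α + cycleCount (Fintype.card α) g
      = g.support.card + Multiset.card g.cycleType + 2 * (Fintype.card α - g.support.card) := by
    unfold cycleCount; omega
  rw [neg_pow C, ← mul_assoc, ← pow_add, h2, pow_add _ (_ + _), pow_mul, neg_one_sq, one_pow,
    mul_one, h1]

end Cycles

/-! ## Decomposing sums over groups of permutations -/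

section Coset

variable {α M : Type*} [AddCommMonoid M]

open Equiv

open scoped Classical in
/-- If the transpositions `(x n)`, `x ∈ O`, lie in `K` and `O` contains the orbit of `n`, they
represent the cosets of the stabilizer of `n`. -/
lemma sum_eq_sum_mul_swap [Fintype α] [DecidableEq α] (K K' : Subgroup (Perm α)) (n : α) (O : Finset α)
    (hK' : ∀ p, p ∈ K' ↔ p ∈ K ∧ p n = n)
    (hO : ∀ x ∈ O, swap x n ∈ K) (hK : ∀ p ∈ K, p n ∈ O) (F : Perm α → M) :
    ∑ p : K, F p = ∑ x ∈ O, ∑ p : K', F (p * swap x n) := by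
  -- The coset of `p` is recorded by `x = p⁻¹ n`; then `p * swap x n` fixes `n`.
  let e : K ≃ O × K' :=
    { toFun := fun p => (⟨(p⁻¹ : K).1 n, hK _ (p⁻¹).2⟩,
        ⟨p.1 * swap ((p⁻¹ : K).1 n) n, (hK' _).2
          ⟨K.mul_mem p.2 (hO _ (hK _ (p⁻¹).2)), by simp⟩⟩)
      invFun := fun q => ⟨q.2.1 * swap q.1.1 n, K.mul_mem ((hK' _).1 q.2.2).1 (hO _ q.1.2)⟩
      left_inv := fun p => by ext1; simp [mul_assoc]
      right_inv := fun ⟨⟨x, hx⟩, ⟨p, hp⟩⟩ => by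
        have h1 : p⁻¹ n = n := by
          rw [Perm.inv_eq_iff_eq]; exact (((hK' _).1 hp).2).symm
        have h2 : (p * swap x n)⁻¹ n = x := by
          rw [mul_inv_rev, Perm.mul_apply, h1, swap_inv, swap_apply_right]
        ext1
        · ext1; exact h2
        · ext1
          change p * swap x n * swap ((p * swap x n)⁻¹ n) n = p
          rw [h2, mul_assoc, swap_mul_self, mul_one] }
  rw [← Finset.sum_coe_sort O, ← Finset.sum_product'
    (f := fun (x : O) (p : K') => F (p.1 * swap x.1 n)), Finset.univ_product_univ]
  refine Fintype.sum_equiv e _ _ fun p => ?_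
  simp [e, mul_assoc]

open scoped Classical in
lemma sum_eq_sum_swap_mul [Fintype α] [DecidableEq α] (K K' : Subgroup (Perm α)) (n : α) (O : Finset α)
    (hK' : ∀ p, p ∈ K' ↔ p ∈ K ∧ p n = n)
    (hO : ∀ x ∈ O, swap x n ∈ K) (hK : ∀ p ∈ K, p n ∈ O) (F : Perm α → M) :
    ∑ p : K, F p = ∑ x ∈ O, ∑ p : K', F (swap x n * p) := by
  rw [← Equiv.sum_comp (Equiv.inv K)]
  have := sum_eq_sum_mul_swap K K' n O hK' hO hK fun p => F p⁻¹
  simp only [Equiv.inv_apply, Subgroup.coe_inv]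
  rw [this]
  refine Finset.sum_congr rfl fun x _ => ?_
  rw [← Equiv.sum_comp (Equiv.inv K')]
  simp

/-- The permutations which fix every point outside `s`. -/
def supportedPerm (s : Finset α) : Subgroup (Perm α) where
  carrier := {p | ∀ x ∉ s, p x = x}
  mul_mem' := fun {p q} hp hq x hx => by rw [Perm.mul_apply, hq x hx, hp x hx]
  one_mem' := fun _ _ => rfl
  inv_mem' := fun {p} hp x hx => by rw [Perm.inv_eq_iff_eq, hp x hx]

/-- The permutations which fix every point outside `s` and preserve the fibres of `f`. -/
def fiberPerm (f : α → ℕ) (s : Finset α) : Subgroup (Perm α) where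
  carrier := {p | p ∈ supportedPerm s ∧ ∀ x, f (p x) = f x}
  mul_mem' := fun {p q} hp hq => ⟨Subgroup.mul_mem _ hp.1 hq.1, fun x => by
    rw [Perm.mul_apply, hp.2, hq.2]⟩
  one_mem' := ⟨Subgroup.one_mem _, fun _ => rfl⟩
  inv_mem' := fun {p} hp => ⟨Subgroup.inv_mem _ hp.1, fun x => by
    simpa using (hp.2 (p⁻¹ x)).symm⟩

lemma mem_fiberPerm {f : α → ℕ} {s : Finset α} {p : Perm α} :
    p ∈ fiberPerm f s ↔ p ∈ supportedPerm s ∧ ∀ x, f (p x) = f x := Iff.rfl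

variable [DecidableEq α]

lemma apply_mem_of_mem_supportedPerm {s : Finset α} {p : Perm α} (hp : p ∈ supportedPerm s)
    {x : α} (hx : x ∈ s) : p x ∈ s := by
  by_contra h
  have := hp _ h
  rw [p.injective this] at h
  exact h hx

lemma card_support_le_of_mem_supportedPerm [Fintype α] {s : Finset α} {p : Perm α}
    (hp : p ∈ supportedPerm s) : p.support.card ≤ s.card :=
  Finset.card_le_card fun x hx => by
    by_contra h
    exact Perm.mem_support.1 hx (hp x h)

lemma swap_mem_supportedPerm {s : Finset α} {x y : α} (hx : x ∈ s) (hy : y ∈ s) :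
    swap x y ∈ supportedPerm s := fun _ hz =>
  swap_apply_of_ne_of_ne (fun h => hz (h ▸ hx)) (fun h => hz (h ▸ hy))

lemma mem_supportedPerm_iff_insert {s : Finset α} {n : α} (hn : n ∉ s) {p : Perm α} :
    p ∈ supportedPerm s ↔ p ∈ supportedPerm (insert n s) ∧ p n = n := by
  constructor
  · exact fun h => ⟨fun x hx => h x fun h' => hx (Finset.mem_insert_of_mem h'), h n hn⟩
  · rintro ⟨h, hp⟩ x hx
    by_cases hxn : x = n
    · rw [hxn, hp]
    · exact h x (by simp [hxn, hx])

lemma swap_mem_fiberPerm {f : α → ℕ} {s : Finset α} {x y : α} (hx : x ∈ s) (hy : y ∈ s)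
    (h : f x = f y) : swap x y ∈ fiberPerm f s := by
  refine ⟨swap_mem_supportedPerm hx hy, fun z => ?_⟩
  by_cases hzx : z = x
  · rw [hzx, swap_apply_left, h]
  by_cases hzy : z = y
  · rw [hzy, swap_apply_right, h]
  rw [swap_apply_of_ne_of_ne hzx hzy]

lemma mem_fiberPerm_iff_insert {f : α → ℕ} {s : Finset α} {n : α} (hn : n ∉ s) (p : Perm α) :
    p ∈ fiberPerm f s ↔ p ∈ fiberPerm f (insert n s) ∧ p n = n := by
  rw [mem_fiberPerm, mem_fiberPerm, mem_supportedPerm_iff_insert hn]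
  tauto

end Coset

/-! ## The content product as a sum over row and column permutations -/

section Content

variable {α : Type*} [Fintype α] [DecidableEq α]

open Equiv

open scoped Classical in
/-- The sum `∑ sgn(p) C^{cyc(pq)}` over row permutations `p` and column permutations `q`. -/
noncomputable def rowColSum (C : ℂ) (r c : α → ℕ) (s : Finset α) : ℂ :=
  ∑ p : fiberPerm r s, ∑ q : fiberPerm c s,
    ((Perm.sign p.1 : ℤ) : ℂ) * C ^ cycleCount s.card (p.1 * q.1)

-- A sign-reversing substitution: `z` is the box in the row of `y` and the column of `x`. Replacing
-- `p` by `p(z y)` and `q` by `(z x)q` preserves `p(x y)q`, since `(z y)(x y)(z x) = (x y)`, while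
-- the sign of `p` changes.
open scoped Classical in
lemma rowColSum_twisted_eq_zero (C : ℂ) (r c : α → ℕ) (s : Finset α) (m : ℕ) {x y z : α}
    (hx : x ∈ s) (hy : y ∈ s) (hz : z ∈ s) (hzx : z ≠ x) (hzy : z ≠ y) (hr : r z = r y)
    (hc : c z = c x) :
    ∑ p : fiberPerm r s, ∑ q : fiberPerm c s,
      ((Perm.sign p.1 : ℤ) : ℂ) * C ^ cycleCount m (p.1 * swap x y * q.1) = 0 := by
  have key : ∀ S : ℂ, S = -S → S = 0 := fun S h => by
    have : 2 * S = 0 := by linear_combination h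
    simpa using this
  apply key
  let t : fiberPerm r s := ⟨swap z y, swap_mem_fiberPerm hz hy hr⟩
  let u : fiberPerm c s := ⟨swap z x, swap_mem_fiberPerm hz hx hc⟩
  refine (Equiv.sum_comp (Equiv.mulRight t) _).symm.trans ?_
  rw [← Finset.sum_neg_distrib]
  refine Finset.sum_congr rfl fun p _ => ?_
  refine (Equiv.sum_comp (Equiv.mulLeft u) _).symm.trans ?_
  rw [← Finset.sum_neg_distrib]
  refine Finset.sum_congr rfl fun q _ => ?_
  have h : swap z y * swap x y * swap z x = swap x y := by
    have : swap x y * swap z x * swap x y = swap z y := by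
      have := swap_apply_apply (swap x y) z x
      rw [swap_apply_of_ne_of_ne hzx hzy, swap_apply_left, swap_inv] at this
      exact this.symm
    rw [← this]
    simp [mul_assoc]
  have hs : Perm.sign (p.1 * swap z y) = -Perm.sign p.1 := by
    rw [Perm.sign_mul, Perm.sign_swap hzy, mul_neg_one]
  have e : (Equiv.mulRight t p).1 * swap x y * (Equiv.mulLeft u q).1
      = p.1 * swap x y * q.1 := by
    change p.1 * swap z y * swap x y * (swap z x * q.1) = _
    rw [← mul_assoc, mul_assoc p.1, mul_assoc p.1, h]
  rw [e, Equiv.coe_mulRight, Subgroup.coe_mul, hs]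
  push_cast
  ring

-- Both groups are decomposed over the stabilizer of the new box `n`. The hypothesis `hs` supplies
-- the fourth corner of the rectangle spanned by `n`, a box of its row and a box of its column,
-- which is what the cancellation of the mixed terms requires.
open scoped Classical in
lemma rowColSum_insert (C : ℂ) (r c : α → ℕ) (s : Finset α) {n : α} (hn : n ∉ s)
    (hinj : ∀ x y, r x = r y → c x = c y → x = y)
    (hs : ∀ x ∈ s, ∀ y ∈ s, r x = r n → c y = c n → ∃ z ∈ s, r z = r y ∧ c z = c x) :
    rowColSum C r c (insert n s)
      = (C - ((s.filter fun x => r x = r n).card - (s.filter fun x => c x = c n).card))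
        * rowColSum C r c s := by
  have hcard : (insert n s).card = s.card + 1 := Finset.card_insert_of_notMem hn
  have hmem : ∀ {f : α → ℕ} {p : Perm α}, p ∈ fiberPerm f s → p n = n := fun hp => hp.1 n hn
  have hO : ∀ f : α → ℕ, ∀ x ∈ insert n (s.filter fun x => f x = f n),
      swap x n ∈ fiberPerm f (insert n s) := by
    intro f x hx
    rcases Finset.mem_insert.1 hx with rfl | hx
    · rw [swap_self]; exact Subgroup.one_mem _
    · rw [Finset.mem_filter] at hx
      exact swap_mem_fiberPerm (Finset.mem_insert_of_mem hx.1) (Finset.mem_insert_self _ _) hx.2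
  have hK : ∀ f : α → ℕ, ∀ p ∈ fiberPerm f (insert n s),
      p n ∈ insert n (s.filter fun x => f x = f n) := by
    intro f p hp
    rw [Finset.mem_insert, Finset.mem_filter]
    rcases Finset.mem_insert.1
      (apply_mem_of_mem_supportedPerm hp.1 (Finset.mem_insert_self n s)) with h | h
    · exact Or.inl h
    · exact Or.inr ⟨h, hp.2 n⟩
  have hnf : ∀ f : α → ℕ, n ∉ s.filter fun x => f x = f n := fun f h =>
    hn (Finset.mem_filter.1 h).1
  have hsup : ∀ {f g : α → ℕ} {p q : Perm α}, p ∈ fiberPerm f s → q ∈ fiberPerm g s →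
      p * q ∈ supportedPerm s := fun hp hq => Subgroup.mul_mem _ hp.1 hq.1
  have hbig : ∀ {p : Perm α}, p ∈ supportedPerm s → p ∈ supportedPerm (insert n s) :=
    fun hp => ((mem_supportedPerm_iff_insert hn).1 hp).1
  have hcyc : ∀ {p : Perm α} {x : α}, p ∈ supportedPerm s → x ∈ s →
      cycleCount (s.card + 1) (p * swap x n) = cycleCount s.card p := by
    intro p x hp hx
    refine cycleCount_mul_swap (card_support_le_of_mem_supportedPerm hp) (hp n hn)
      (fun h => hn (h ▸ hx)) ?_
    rw [← hcard]
    exact card_support_le_of_mem_supportedPerm (Subgroup.mul_mem _ (hbig hp)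
      (swap_mem_supportedPerm (Finset.mem_insert_of_mem hx) (Finset.mem_insert_self _ _)))
  set R := s.filter fun x => r x = r n with hR
  set L := s.filter fun x => c x = c n with hL
  have hRs : ∀ x ∈ R, x ∈ s ∧ r x = r n := fun x hx => Finset.mem_filter.1 hx
  have hLs : ∀ x ∈ L, x ∈ s ∧ c x = c n := fun x hx => Finset.mem_filter.1 hx
  let T : α → α → ℂ := fun x y => ∑ p : fiberPerm r s, ∑ q : fiberPerm c s,
    ((Perm.sign (p.1 * swap x n) : ℤ) : ℂ)
      * C ^ cycleCount (s.card + 1) (p.1 * swap x n * (swap y n * q.1))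
  have hdec : rowColSum C r c (insert n s) = ∑ x ∈ insert n R, ∑ y ∈ insert n L, T x y := by
    rw [rowColSum, hcard, sum_eq_sum_mul_swap (fiberPerm r (insert n s)) (fiberPerm r s) n
      (insert n R) (mem_fiberPerm_iff_insert hn) (hO r) (hK r)
      fun p => ∑ q : fiberPerm c (insert n s),
        ((Perm.sign p : ℤ) : ℂ) * C ^ cycleCount (s.card + 1) (p * q.1)]
    refine Finset.sum_congr rfl fun x _ => ?_
    refine Eq.trans ?_ Finset.sum_comm
    refine Finset.sum_congr rfl fun p _ => ?_
    exact sum_eq_sum_swap_mul (fiberPerm c (insert n s)) (fiberPerm c s) n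
      (insert n L) (mem_fiberPerm_iff_insert hn) (hO c) (hK c)
      fun q => ((Perm.sign (p.1 * swap x n) : ℤ) : ℂ)
        * C ^ cycleCount (s.card + 1) (p.1 * swap x n * q)
  have hsign : ∀ x ∈ R, ∀ p : Perm α, ((Perm.sign (p * swap x n) : ℤ) : ℂ)
      = -((Perm.sign p : ℤ) : ℂ) := by
    intro x hx p
    have hxn : x ≠ n := fun h => hn (h ▸ (hRs x hx).1)
    rw [Perm.sign_mul, Perm.sign_swap hxn]
    simp
  have hnn : T n n = C * rowColSum C r c s := by
    simp only [T, swap_self, ← Perm.one_def, mul_one, one_mul, rowColSum, Finset.mul_sum]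
    refine Finset.sum_congr rfl fun p _ => Finset.sum_congr rfl fun q _ => ?_
    rw [cycleCount_succ (card_support_le_of_mem_supportedPerm (hsup p.2 q.2)), pow_succ]
    ring
  have hny : ∀ y ∈ L, T n y = rowColSum C r c s := by
    intro y hy
    simp only [T, swap_self, ← Perm.one_def, mul_one, rowColSum]
    refine Finset.sum_congr rfl fun p _ => Finset.sum_congr rfl fun q _ => ?_
    rw [← mul_assoc, cycleCount_mul_comm, ← mul_assoc, hcyc (hsup q.2 p.2) (hLs y hy).1,
      cycleCount_mul_comm]
  have hxn : ∀ x ∈ R, T x n = -rowColSum C r c s := by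
    intro x hx
    simp only [T, swap_self, ← Perm.one_def, one_mul, rowColSum, ← Finset.sum_neg_distrib]
    refine Finset.sum_congr rfl fun p _ => Finset.sum_congr rfl fun q _ => ?_
    rw [hsign x hx, cycleCount_mul_comm, ← mul_assoc, hcyc (hsup q.2 p.2) (hRs x hx).1,
      cycleCount_mul_comm]
    ring
  have hxy : ∀ x ∈ R, ∀ y ∈ L, T x y = 0 := by
    intro x hx y hy
    obtain ⟨hxs, hxr⟩ := hRs x hx
    obtain ⟨hys, hyc⟩ := hLs y hy
    have hxn' : x ≠ n := fun h => hn (h ▸ hxs)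
    have hyn' : y ≠ n := fun h => hn (h ▸ hys)
    have hxyne : x ≠ y := fun h => hxn' (hinj x n hxr (h ▸ hyc))
    obtain ⟨z, hz, hzr, hzc⟩ := hs x hxs y hys hxr hyc
    have hzx : z ≠ x := fun h => hyn' (hinj y n (by rw [← hzr, h, hxr]) hyc)
    have hzy : z ≠ y := fun h => hxn' (hinj x n hxr (by rw [← hzc, h, hyc]))
    have h0 := rowColSum_twisted_eq_zero C r c s s.card hxs hys hz hzx hzy hzr hzc
    rw [← neg_eq_zero, ← Finset.sum_neg_distrib] at h0
    rw [← h0]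
    refine Finset.sum_congr rfl fun p _ => ?_
    rw [← Finset.sum_neg_distrib]
    refine Finset.sum_congr rfl fun q _ => ?_
    -- After this rewriting only `(x n)` involves `n`; absorbing it leaves the sum twisted by `(x
    -- y)`, which vanishes.
    have hsw : swap x n * swap y n = swap x y * swap x n := by
      have := swap_apply_apply (swap x n) y n
      rw [swap_apply_of_ne_of_ne hxyne.symm hyn', swap_apply_right, swap_inv] at this
      rw [swap_comm x y, this, mul_assoc, swap_mul_self, mul_one]
    have e : p.1 * swap x n * (swap y n * q.1) = p.1 * swap x y * swap x n * q.1 := by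
      rw [mul_assoc p.1, ← mul_assoc (swap x n), hsw]
      simp only [mul_assoc]
    rw [hsign x hx, e, cycleCount_mul_comm, ← mul_assoc, hcyc _ hxs, cycleCount_mul_comm]
    · ring
    · exact Subgroup.mul_mem _ q.2.1 (Subgroup.mul_mem _ p.2.1 (swap_mem_supportedPerm hxs hys))
  rw [hdec, Finset.sum_insert (hnf r), Finset.sum_insert (hnf c), hnn,
    Finset.sum_congr rfl hny, Finset.sum_congr rfl fun x hx => Finset.sum_insert (hnf c),
    Finset.sum_congr rfl fun x hx => congrArg₂ (· + ·) (hxn x hx)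
      (Finset.sum_congr rfl (hxy x hx))]
  simp only [Finset.sum_const, nsmul_eq_mul, smul_zero]
  ring

/-- For a set of cells which is a Young diagram, the signed sum over row and column permutations
is the content product. -/
theorem rowColSum_eq_prod (C : ℂ) (r c : α → ℕ)
    (hinj : ∀ x y, r x = r y → c x = c y → x = y) (s : Finset α)
    (hs : ∀ x ∈ s, ∀ a ≤ r x, ∀ b ≤ c x, ∃ y ∈ s, r y = a ∧ c y = b) :
    rowColSum C r c s = ∏ x ∈ s, (C - ((c x : ℂ) - (r x : ℂ))) := by
  classical
  induction hk : s.card generalizing s with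
  | zero =>
    rw [Finset.card_eq_zero] at hk
    subst hk
    have h1 : ∀ f : α → ℕ, ∀ p : fiberPerm f ∅, p = 1 := fun f p => by
      ext x; exact p.2.1 x (Finset.notMem_empty _)
    have : ∀ f : α → ℕ, Unique (fiberPerm f (∅ : Finset α)) := fun f => ⟨⟨1⟩, h1 f⟩
    rw [rowColSum, Fintype.sum_unique, Fintype.sum_unique, h1 r default, h1 c default]
    simp [cycleCount_one]
  | succ k ih =>
    -- A box with maximal row plus column index is a corner, so the remaining boxes still form a
    -- diagram.
    obtain ⟨n, hn, hmax⟩ := s.exists_max_image (fun x => r x + c x)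
      (Finset.card_pos.1 (by omega))
    have hmaxr : ∀ x ∈ s, r x = r n → c x ≤ c n := fun x hx h => by
      have := hmax x hx; omega
    have hmaxc : ∀ x ∈ s, c x = c n → r x ≤ r n := fun x hx h => by
      have := hmax x hx; omega
    have hne : ∀ x ∈ s.erase n, ∀ a ≤ r x, ∀ b ≤ c x, ∃ y ∈ s.erase n, r y = a ∧ c y = b := by
      intro x hx a ha b hb
      rw [Finset.mem_erase] at hx
      obtain ⟨y, hy, rfl, rfl⟩ := hs x hx.2 a ha b hb
      refine ⟨y, Finset.mem_erase.2 ⟨?_, hy⟩, rfl, rfl⟩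
      rintro rfl
      have := hmax x hx.2
      exact hx.1 (hinj _ _ (by omega) (by omega))
    have hnot : n ∉ s.erase n := Finset.notMem_erase n s
    -- The other boxes in the row of the corner `n` occupy exactly the columns `0, …, c n - 1`;
    -- similarly for its column below.
    have hcR : ((s.erase n).filter fun x => r x = r n).card = c n := by
      rw [← Finset.card_range (c n)]
      refine Finset.card_bij (fun x _ => c x) ?_ ?_ ?_
      · intro x hx
        simp only [Finset.mem_filter, Finset.mem_erase] at hx
        have := hmaxr x hx.1.2 hx.2
        rw [Finset.mem_range]
        exact lt_of_le_of_ne this fun h => hx.1.1 (hinj _ _ hx.2 h)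
      · intro x hx y hy h
        exact hinj _ _ ((Finset.mem_filter.1 hx).2.trans (Finset.mem_filter.1 hy).2.symm) h
      · intro b hb
        rw [Finset.mem_range] at hb
        obtain ⟨y, hy, h1, h2⟩ := hs n hn (r n) le_rfl b hb.le
        refine ⟨y, ?_, h2⟩
        simp only [Finset.mem_filter, Finset.mem_erase]
        exact ⟨⟨fun h => by rw [h] at h2; omega, hy⟩, h1⟩
    have hcL : ((s.erase n).filter fun x => c x = c n).card = r n := by
      rw [← Finset.card_range (r n)]
      refine Finset.card_bij (fun x _ => r x) ?_ ?_ ?_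
      · intro x hx
        simp only [Finset.mem_filter, Finset.mem_erase] at hx
        have := hmaxc x hx.1.2 hx.2
        rw [Finset.mem_range]
        exact lt_of_le_of_ne this fun h => hx.1.1 (hinj _ _ h hx.2)
      · intro x hx y hy h
        exact hinj _ _ h ((Finset.mem_filter.1 hx).2.trans (Finset.mem_filter.1 hy).2.symm)
      · intro b hb
        rw [Finset.mem_range] at hb
        obtain ⟨y, hy, h1, h2⟩ := hs n hn b hb.le (c n) le_rfl
        refine ⟨y, ?_, h1⟩
        simp only [Finset.mem_filter, Finset.mem_erase]
        exact ⟨⟨fun h => by rw [h] at h1; omega, hy⟩, h2⟩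
    have hstep := rowColSum_insert C r c (s.erase n) hnot hinj (by
      intro x hx y hy hxr hyc
      have hx' := Finset.mem_erase.1 hx
      have hy' := Finset.mem_erase.1 hy
      exact hne y hy (r y) le_rfl (c x) (by rw [hyc]; exact hmaxr x hx'.2 hxr))
    rw [Finset.insert_erase hn, hcR, hcL, ih _ hne (by rw [Finset.card_erase_of_mem hn]; omega)]
      at hstep
    rw [hstep, Finset.mul_prod_erase s (fun x => C - ((c x : ℂ) - (r x : ℂ))) hn]

end Content

/-! ## The Gram matrix of the permuted states -/

lemma Derivation.map_finset_prod {R A α : Type*} [CommSemiring R] [CommSemiring A] [Algebra R A]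
    [DecidableEq α] (D : Derivation R A A) (s : Finset α) (f : α → A) :
    D (∏ a ∈ s, f a) = ∑ a ∈ s, (∏ b ∈ s.erase a, f b) * D (f a) := by
  induction s using Finset.induction_on with
  | empty => simp
  | insert n s hn ih =>
    rw [Finset.prod_insert hn, Derivation.leibniz, ih, Finset.sum_insert hn,
      Finset.erase_insert hn, add_comm, smul_eq_mul, smul_eq_mul, Finset.mul_sum]
    congr 1
    refine Finset.sum_congr rfl fun a ha => ?_
    have han : n ≠ a := fun h => hn (h ▸ ha)
    rw [Finset.erase_insert_of_ne han, Finset.prod_insert fun h => hn (Finset.mem_of_mem_erase h),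
      mul_assoc]

section Gram

variable {α : Type*} [DecidableEq α]

open Equiv

/-- The monomial `∏ X(-i_a,-j_a)`. -/
noncomputable def gramMonomial (i j : α → ℤ) (s : Finset α) : MvPolynomial (ℤ × ℤ) ℂ :=
  ∏ a ∈ s, MvPolynomial.X (-(i a), -(j a))

-- At the factor of index `x`, the derivation for the new index `b` puts `-X(-i_b,-j_{p x})
-- X(-i_x,-j_b)` in place of `X(-i_x,-j_{p x})`. This is the passage from `p` to `p * swap x b`, and
-- -1 is the sign of the transposition. The multiplication part keeps `p`, with `b` as a new fixed
-- point, and contributes the factor `C`.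
open scoped Classical in
lemma glRep_list_prod [Fintype α] (C : ℂ) (i j : α → ℤ) (hi : ∀ a, 0 < i a) (hj : ∀ a, 0 ≤ j a)
    (l : List α) (hl : l.Nodup) :
    glRep C (l.map fun a => genE C (-(i a)) (-(j a))).prod 1
      = ∑ p : supportedPerm l.toFinset,
        (((Perm.sign p.1 : ℤ) : ℂ) * C ^ cycleCount l.toFinset.card p.1) •
          gramMonomial i (j ∘ p.1) l.toFinset := by
  induction l with
  | nil =>
    have h1 : ∀ p : supportedPerm ([] : List α).toFinset, p = 1 := fun p => by
      ext x; exact p.2 x (Finset.notMem_empty _)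
    have : Unique (supportedPerm ([] : List α).toFinset) := ⟨⟨1⟩, h1⟩
    rw [Fintype.sum_unique, h1 default]
    simp [cycleCount_one, gramMonomial]
  | cons b l ih =>
    rw [List.nodup_cons] at hl
    set s := l.toFinset with hs
    have hb : b ∉ s := by rw [hs, List.mem_toFinset]; exact hl.1
    have hcard : (insert b s).card = s.card + 1 := Finset.card_insert_of_notMem hb
    rw [List.map_cons, List.prod_cons, map_mul, Module.End.mul_apply, ih hl.2, glRep_genE,
      List.toFinset_cons, ← hs, hcard]
    have hK : ∀ p ∈ supportedPerm (insert b s), p b ∈ insert b s := fun p hp =>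
      apply_mem_of_mem_supportedPerm hp (Finset.mem_insert_self b s)
    have hO : ∀ x ∈ insert b s, swap x b ∈ supportedPerm (insert b s) := fun x hx =>
      swap_mem_supportedPerm hx (Finset.mem_insert_self b s)
    rw [sum_eq_sum_mul_swap (supportedPerm (insert b s)) (supportedPerm s) b (insert b s)
      (fun p => mem_supportedPerm_iff_insert hb) hO hK fun p =>
        (((Perm.sign p : ℤ) : ℂ) * C ^ cycleCount (s.card + 1) p) •
          gramMonomial i (j ∘ p) (insert b s),
      Finset.sum_comm, map_sum]
    refine Finset.sum_congr rfl fun p _ => ?_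
    have hpb : p.1 b = b := p.2 b hb
    rw [map_smul, Finset.sum_insert hb, glOp_apply, add_comm, smul_add]
    congr 1
    · rw [glShift, if_pos ⟨by have := hi b; omega, by have := hj b; omega⟩, swap_self,
        ← Perm.one_def, mul_one, cycleCount_succ (card_support_le_of_mem_supportedPerm p.2),
        gramMonomial, gramMonomial, Finset.prod_insert hb, Function.comp_apply, hpb, pow_succ,
        smul_mul_assoc, smul_smul, mul_assoc]
    · rw [gramMonomial, Derivation.map_finset_prod, Finset.smul_sum]
      refine Finset.sum_congr rfl fun x hx => ?_
      have hxb : x ≠ b := fun h => hb (h ▸ hx)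
      have hsw : (p.1 * swap x b).support.card ≤ s.card + 1 := by
        rw [← hcard]
        exact card_support_le_of_mem_supportedPerm (Subgroup.mul_mem _
          ((mem_supportedPerm_iff_insert hb).1 p.2).1 (hO x (Finset.mem_insert_of_mem hx)))
      rw [cycleCount_mul_swap (card_support_le_of_mem_supportedPerm p.2) hpb hxb hsw,
        Perm.sign_mul, Perm.sign_swap hxb, mul_neg_one, gramMonomial, Finset.prod_insert hb,
        ← Finset.mul_prod_erase s _ hx, glDer_X, rowEntry, colEntry,
        if_pos (by have := hi b; omega), if_pos (by have := hj b; omega)]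
      have e : ∏ a ∈ s.erase x, MvPolynomial.X (R := ℂ) (-(i a), -((j ∘ (p.1 * swap x b)) a))
          = ∏ a ∈ s.erase x, MvPolynomial.X (-(i a), -((j ∘ p.1) a)) := by
        refine Finset.prod_congr rfl fun a ha => ?_
        have hab : a ≠ b := fun h => hb (h ▸ Finset.mem_of_mem_erase ha)
        rw [Function.comp_apply, Perm.mul_apply,
          swap_apply_of_ne_of_ne (Finset.ne_of_mem_erase ha) hab, Function.comp_apply]
      rw [e]
      simp only [Function.comp_apply, Perm.mul_apply, swap_apply_left, swap_apply_right, hpb,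
        Units.val_neg, Int.cast_neg, neg_mul, neg_smul, mul_neg, smul_neg]
      congr 2
      ring

/-- The adjoint of a raising generator is the pure derivative `∂/∂X(-i_b,-j_b)`. As the `i_a` are
distinct, it can only hit the factor of index `b`. -/
lemma vermaToDual_list_prod (C : ℂ) (τ : ℂ →+* ℂ) (hτ : τ C = C) (i j k : α → ℤ)
    (hi : ∀ a, 0 < i a) (hj : ∀ a, 0 ≤ j a) (hinj : Function.Injective i)
    (l : List α) (hl : l.Nodup) :
    vermaToDual C τ hτ ((l.map fun a => genE C (-(i a)) (-(j a))).prod • vac C)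
        (gramMonomial i k l.toFinset)
      = if ∀ a ∈ l, j a = k a then 1 else 0 := by
  induction l with
  | nil => simp [vermaToDual_vac, gramMonomial]
  | cons b l ih =>
    rw [List.nodup_cons] at hl
    have hb : b ∉ l.toFinset := by rw [List.mem_toFinset]; exact hl.1
    have hd : ∀ a, glDer (j b) (i b) (MvPolynomial.X (-(i a), -(k a)))
        = if a = b ∧ j b = k b then 1 else 0 := by
      intro a
      have h1 : i b + -i a = 0 ↔ a = b := by
        rw [← sub_eq_add_neg, sub_eq_zero]
        exact ⟨fun h => hinj h.symm, fun h => by rw [h]⟩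
      have h2 : j b + -k a = 0 ↔ j b = k a := by omega
      rw [glDer_X, rowEntry, colEntry, if_neg (not_lt.2 (hj b)), if_neg (not_le.2 (hi b))]
      simp only [h1, h2]
      by_cases hab : a = b
      · subst hab; split_ifs <;> simp_all
      · simp [hab]
    rw [List.map_cons, List.prod_cons, mul_smul, vermaToDual_smul, neg_neg, neg_neg, glOp_apply,
      glShift, if_neg (by have := hi b; omega), zero_mul, add_zero, gramMonomial,
      Derivation.map_finset_prod, List.toFinset_cons, Finset.sum_insert hb,
      Finset.erase_insert hb, Finset.sum_eq_zero, add_zero, hd]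
    · by_cases h : j b = k b
      · rw [if_pos ⟨rfl, h⟩, mul_one]
        refine (ih hl.2).trans ?_
        simp [h]
      · simp [h]
    · intro a ha
      have hab : a ≠ b := fun h => hb (h ▸ ha)
      rw [hd, if_neg fun h => hab h.1, mul_zero]

lemma permState_eq (C : ℂ) {n : ℕ} (i j : Fin n → ℤ) (σ : Perm (Fin n)) :
    permState C i j σ
      = ((List.finRange n).map fun a => genE C (-(i a)) (-(j (σ a)))).prod • vac C := by
  rw [permState, List.ofFn_eq_map]

lemma toFinset_finRange (n : ℕ) : (List.finRange n).toFinset = Finset.univ := by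
  ext; simp

/-- The monomials are a dual family for the permuted states whatever `C` is, so these states are
independent even where the form degenerates. -/
lemma vermaToDual_permState (C : ℂ) (τ : ℂ →+* ℂ) (hτ : τ C = C) {n : ℕ} (i j : Fin n → ℤ)
    (hi : Function.Injective i) (hj : Function.Injective j) (hi' : ∀ a, 0 < i a)
    (hj' : ∀ a, 0 ≤ j a) (σ ρ : Perm (Fin n)) :
    vermaToDual C τ hτ (permState C i j σ) (gramMonomial i (j ∘ ρ) Finset.univ)
      = if σ = ρ then 1 else 0 := by
  have h := vermaToDual_list_prod C τ hτ i (j ∘ σ) (j ∘ ρ) hi' (fun _ => hj' _) hi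
    (List.finRange n) (List.nodup_finRange n)
  rw [toFinset_finRange] at h
  rw [permState_eq]
  refine h.trans ?_
  simp only [List.mem_finRange, Function.comp_apply, true_imp_iff, hj.eq_iff, Equiv.ext_iff]

lemma vermaToPoly_permState (C : ℂ) {n : ℕ} (i j : Fin n → ℤ)
    (hi' : ∀ a, 0 < i a) (hj' : ∀ a, 0 ≤ j a) (σ : Perm (Fin n)) :
    vermaToPoly C (permState C i j σ)
      = ∑ p : Perm (Fin n), (((Perm.sign p : ℤ) : ℂ) * C ^ cycleCount n p) •
          gramMonomial i (j ∘ (σ * p : Perm (Fin n))) Finset.univ := by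
  classical
  have h := glRep_list_prod C i (j ∘ σ) hi' (fun a => hj' _) (List.finRange n)
    (List.nodup_finRange n)
  rw [toFinset_finRange, Finset.card_univ, Fintype.card_fin] at h
  rw [permState_eq, vermaToPoly_smul, vermaToPoly_vac]
  let e : supportedPerm (Finset.univ : Finset (Fin n)) ≃ Perm (Fin n) :=
    ⟨Subtype.val, fun p => ⟨p, fun x hx => absurd (Finset.mem_univ x) hx⟩, fun _ => rfl,
      fun _ => rfl⟩
  exact h.trans (Fintype.sum_equiv e _ _ fun p => rfl)

/-- The scalar product of two permuted states. -/
theorem vermaForm_permState (C : ℂ) (τ : ℂ →+* ℂ) (hτ : τ C = C) {n : ℕ} (i j : Fin n → ℤ)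
    (hi : Function.Injective i) (hj : Function.Injective j) (hi' : ∀ a, 0 < i a)
    (hj' : ∀ a, 0 ≤ j a) (σ ρ : Perm (Fin n)) :
    vermaForm C τ hτ (permState C i j σ) (permState C i j ρ)
      = ((Perm.sign (ρ⁻¹ * σ) : ℤ) : ℂ) * C ^ cycleCount n (ρ⁻¹ * σ) := by
  rw [vermaForm_apply, vermaToPoly_permState C i j hi' hj', map_sum,
    Finset.sum_eq_single (ρ⁻¹ * σ)]
  · rw [map_smul, vermaToDual_permState C τ hτ i j hi hj hi' hj', if_pos (by simp), smul_eq_mul,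
      mul_one]
  · intro p _ hp
    rw [map_smul, vermaToDual_permState C τ hτ i j hi hj hi' hj', if_neg, smul_zero]
    rintro rfl
    exact hp (by simp)
  · simp

/-- The permuted states are linearly independent. -/
theorem permState_linearIndependent (C : ℂ) {n : ℕ} (i j : Fin n → ℤ)
    (hi : Function.Injective i) (hj : Function.Injective j) (hi' : ∀ a, 0 < i a)
    (hj' : ∀ a, 0 ≤ j a) : LinearIndependent ℂ (permState C i j) := by
  rw [Fintype.linearIndependent_iff]
  intro g hg σ
  have := congrArg (fun v => vermaToDual C (RingHom.id ℂ) rfl v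
    (gramMonomial i (j ∘ σ) Finset.univ)) hg
  simpa [map_sum, vermaToDual_permState C (RingHom.id ℂ) rfl i j hi hj hi' hj'] using this

end Gram

/-! ## Combinatorics of fillings of Young diagrams -/

section Tableau

open Equiv

variable {n : ℕ} {Y Y' : YoungDiagram}

/-- The row of the box of `Y` which is filled with `a`. -/
def tabRow (T : Fin n ≃ Y.cells) (a : Fin n) : ℕ := (T a).1.1

/-- The column of the box of `Y` which is filled with `a`. -/
def tabCol (T : Fin n ≃ Y.cells) (a : Fin n) : ℕ := (T a).1.2

lemma tab_ext (T : Fin n ≃ Y.cells) {a b : Fin n} (hr : tabRow T a = tabRow T b)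
    (hc : tabCol T a = tabCol T b) : a = b :=
  T.injective (Subtype.ext (Prod.ext hr hc))

lemma tab_mem (T : Fin n ≃ Y.cells) (a : Fin n) : (tabRow T a, tabCol T a) ∈ Y :=
  (YoungDiagram.mem_cells _).1 (T a).2

lemma exists_tab (T : Fin n ≃ Y.cells) {r c : ℕ} (h : (r, c) ∈ Y) :
    ∃ a, tabRow T a = r ∧ tabCol T a = c :=
  ⟨T.symm ⟨(r, c), (YoungDiagram.mem_cells _).2 h⟩, by simp [tabRow], by simp [tabCol]⟩

/-- No two entries share a row of `T` and a column of `T'`. -/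
def RowColDisjoint (T : Fin n ≃ Y.cells) (T' : Fin n ≃ Y'.cells) : Prop :=
  ∀ a b, tabRow T a = tabRow T b → tabCol T' a = tabCol T' b → a = b

/-- Entries of one column of `T'` lie in distinct rows of `T`, so at most `k` of them are in the
first `k` rows of `T`. In `T'` itself the count is the smaller of `k` and the column length. Summed
over columns, this is the dominance inequality for the shapes. -/
lemma RowColDisjoint.card_le {T : Fin n ≃ Y.cells} {T' : Fin n ≃ Y'.cells}
    (h : RowColDisjoint T T') (k c : ℕ) :
    (Finset.univ.filter fun a => tabRow T a < k ∧ tabCol T' a = c).card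
      ≤ (Finset.univ.filter fun a => tabRow T' a < k ∧ tabCol T' a = c).card := by
  by_cases hk : ∀ a, tabCol T' a = c → tabRow T' a < k
  · refine Finset.card_le_card fun a ha => ?_
    simp only [Finset.mem_filter, Finset.mem_univ, true_and] at ha ⊢
    exact ⟨hk a ha.2, ha.2⟩
  · push Not at hk
    obtain ⟨b, hb, hbk⟩ := hk
    calc _ ≤ (Finset.range k).card := by
          refine Finset.card_le_card_of_injOn (tabRow T) ?_ ?_
          · intro a ha
            simp only [Finset.coe_filter, Finset.mem_univ, true_and, Set.mem_ofPred_eq] at ha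
            simpa using ha.1
          · intro a ha a' ha' he
            simp only [Finset.coe_filter, Finset.mem_univ, true_and, Set.mem_ofPred_eq] at ha ha'
            exact h a a' he (ha.2.trans ha'.2.symm)
      _ ≤ _ := by
          refine Finset.card_le_card_of_surjOn (tabRow T') ?_
          intro i hi
          simp only [Finset.coe_range, Set.mem_Iio] at hi
          obtain ⟨a, har, hac⟩ := exists_tab T' (r := i) (c := c)
            (Y'.up_left_mem (by omega) (by omega) (tab_mem T' b))
          refine ⟨a, ?_, har⟩
          simp [har, hac, hi]

lemma card_rows_eq_sum (T : Fin n ≃ Y.cells) (T' : Fin n ≃ Y'.cells) (k : ℕ) :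
    (Finset.univ.filter fun a => tabRow T a < k).card
      = ∑ c ∈ Finset.univ.image (tabCol T'),
        (Finset.univ.filter fun a => tabRow T a < k ∧ tabCol T' a = c).card := by
  rw [Finset.card_eq_sum_card_fiberwise (f := tabCol T') (t := Finset.univ.image (tabCol T'))
    fun a _ => by simp]
  exact Finset.sum_congr rfl fun c _ => by rw [Finset.filter_filter]

lemma RowColDisjoint.card_rows_le {T : Fin n ≃ Y.cells} {T' : Fin n ≃ Y'.cells}
    (h : RowColDisjoint T T') (k : ℕ) :
    (Finset.univ.filter fun a => tabRow T a < k).card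
      ≤ (Finset.univ.filter fun a => tabRow T' a < k).card := by
  rw [card_rows_eq_sum T T', card_rows_eq_sum T' T']
  exact Finset.sum_le_sum fun c _ => h.card_le k c

lemma card_row_succ (f g : Fin n → ℕ) (k c : ℕ) :
    (Finset.univ.filter fun a => f a < k + 1 ∧ g a = c).card
      = (Finset.univ.filter fun a => f a < k ∧ g a = c).card
        + (Finset.univ.filter fun a => f a = k ∧ g a = c).card := by
  rw [← Finset.card_union_of_disjoint]
  · congr 1
    ext a
    simp only [Finset.mem_filter, Finset.mem_univ, true_and, Finset.mem_union]
    omega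
  · rw [Finset.disjoint_left]
    intro a ha hb
    simp only [Finset.mem_filter, Finset.mem_univ, true_and] at ha hb
    omega

lemma rowLen_eq_card_tabRow (T : Fin n ≃ Y.cells) (k : ℕ) :
    Y.rowLen k = (Finset.univ.filter fun a => tabRow T a = k).card := by
  rw [YoungDiagram.rowLen_eq_card]
  symm
  refine Finset.card_bij (fun a _ => (T a).1) ?_ ?_ ?_
  · intro a ha
    rw [YoungDiagram.mem_row_iff]
    exact ⟨tab_mem T a, (Finset.mem_filter.1 ha).2⟩
  · exact fun a _ b _ h => T.injective (Subtype.ext h)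
  · intro x hx
    rw [YoungDiagram.mem_row_iff] at hx
    exact ⟨T.symm ⟨x, (YoungDiagram.mem_cells _).2 hx.1⟩, by
      rw [Finset.mem_filter]; simp [tabRow, hx.2], by simp⟩

/-- Fillings which are row-column disjoint both ways have the same shape. -/
lemma eq_of_rowColDisjoint {T T₁ : Fin n ≃ Y.cells} {T' T₁' : Fin n ≃ Y'.cells}
    (h : RowColDisjoint T T') (h' : RowColDisjoint T₁' T₁) : Y = Y' := by
  have hcard : ∀ (Z : YoungDiagram) (S : Fin n ≃ Z.cells) (k : ℕ),
      (Finset.univ.filter fun a => tabRow S a < k).card = ∑ i ∈ Finset.range k, Z.rowLen i := by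
    intro Z S k
    rw [Finset.card_eq_sum_card_fiberwise (f := tabRow S) (t := Finset.range k)]
    · refine Finset.sum_congr rfl fun i hi => ?_
      rw [Finset.mem_range] at hi
      rw [rowLen_eq_card_tabRow S, Finset.filter_filter]
      congr 1
      ext a
      simp only [Finset.mem_filter, Finset.mem_univ, true_and]
      omega
    · intro a ha
      simpa using ha
  have hle : ∀ k, ∑ i ∈ Finset.range k, Y.rowLen i = ∑ i ∈ Finset.range k, Y'.rowLen i := by
    intro k
    refine le_antisymm ?_ ?_
    · rw [← hcard Y T, ← hcard Y' T']; exact h.card_rows_le k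
    · rw [← hcard Y T₁, ← hcard Y' T₁']; exact h'.card_rows_le k
  have hrow : ∀ k, Y.rowLen k = Y'.rowLen k := by
    intro k
    have h1 := hle (k + 1)
    rw [Finset.sum_range_succ, Finset.sum_range_succ, hle k] at h1
    omega
  refine YoungDiagram.ext (Finset.ext fun ⟨r, c⟩ => ?_)
  rw [YoungDiagram.mem_cells, YoungDiagram.mem_cells, YoungDiagram.mem_iff_lt_rowLen,
    YoungDiagram.mem_iff_lt_rowLen, hrow]

/-- If no two entries share a row of `T` and a column of `σT`, then `σ` is the product of a row
permutation and a column permutation of `T`. -/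
lemma exists_row_mul_col (T : Fin n ≃ Y.cells) (σ : Perm (Fin n))
    (h : RowColDisjoint T (σ.symm.trans T)) :
    ∃ p ∈ fiberPerm (tabRow T) Finset.univ, ∃ q ∈ fiberPerm (tabCol T) Finset.univ,
      σ = p * q := by
  set T' : Fin n ≃ Y.cells := σ.symm.trans T with hT'
  have hr : ∀ a, tabRow T' (σ a) = tabRow T a := fun a => by simp [T', tabRow]
  have hc : ∀ a, tabCol T' (σ a) = tabCol T a := fun a => by simp [T', tabCol]
  have hrows : ∀ k, (Finset.univ.filter fun a => tabRow T a < k).card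
      = (Finset.univ.filter fun a => tabRow T' a < k).card := fun k =>
    Finset.card_bij (fun a _ => σ a) (fun a ha => by simpa [hr] using ha)
      (fun a _ b _ hab => σ.injective hab)
      (fun b hb => ⟨σ.symm b, by
        have := hr (σ.symm b)
        rw [apply_symm_apply] at this
        simpa [← this] using hb, by simp⟩)
  have heq : ∀ k c, (Finset.univ.filter fun a => tabRow T a < k ∧ tabCol T' a = c).card
      = (Finset.univ.filter fun a => tabRow T' a < k ∧ tabCol T' a = c).card := by
    intro k c
    have h1 := hrows k
    rw [card_rows_eq_sum T T', card_rows_eq_sum T' T'] at h1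
    -- Both fillings have the same shape, so the dominance inequality is an equality, column by
    -- column.
    have h2 := (Finset.sum_eq_sum_iff_of_le fun c _ => h.card_le k c).1 h1
    by_cases hcm : c ∈ Finset.univ.image (tabCol T')
    · exact h2 c hcm
    · have : ∀ a, tabCol T' a ≠ c := fun a ha => hcm (by simp [← ha])
      simp [this]
  -- So the columns of `T'` can be rearranged until every entry is in its row of `T`; the map `b ↦
  -- a` is this rearrangement.
  have hex : ∀ b, ∃ a, tabRow T a = tabRow T' b ∧ tabCol T' a = tabCol T' b := by
    intro b
    have h1 := heq (tabRow T' b + 1) (tabCol T' b)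
    rw [card_row_succ, card_row_succ, heq, add_right_inj] at h1
    have h2 : 0 < (Finset.univ.filter fun a =>
        tabRow T a = tabRow T' b ∧ tabCol T' a = tabCol T' b).card := by
      rw [h1]
      exact Finset.card_pos.2 ⟨b, by simp⟩
    obtain ⟨a, ha⟩ := Finset.card_pos.1 h2
    exact ⟨a, (Finset.mem_filter.1 ha).2⟩
  choose t ht1 ht2 using hex
  have hinj : Function.Injective t := fun a b hab =>
    tab_ext T' ((ht1 a).symm.trans ((congrArg _ hab).trans (ht1 b)))
      ((ht2 a).symm.trans ((congrArg _ hab).trans (ht2 b)))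
  let τ : Perm (Fin n) := Equiv.ofBijective t (Finite.injective_iff_bijective.1 hinj)
  have hτ : ∀ a, τ a = t a := fun a => rfl
  have huniv : ∀ p : Perm (Fin n), p ∈ supportedPerm Finset.univ := fun p x hx =>
    absurd (Finset.mem_univ x) hx
  refine ⟨τ * σ, ⟨huniv _, fun a => ?_⟩, (σ⁻¹ * τ * σ)⁻¹,
    Subgroup.inv_mem _ ⟨huniv _, fun a => ?_⟩, by group⟩
  · rw [Perm.mul_apply, hτ, ht1, hr]
  · rw [Perm.mul_apply, Perm.mul_apply, ← hc, Perm.inv_def, apply_symm_apply, hτ, ht2, hc]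

end Tableau

/-! ## Young symmetrizers and Specht modules -/

section Young

open Equiv MonoidAlgebra

variable {n : ℕ} {Y Y' : YoungDiagram}

open scoped Classical in
lemma rowSymmetrizer_eq (T : Fin n ≃ Y.cells) :
    rowSymmetrizer T = ∑ p : fiberPerm (tabRow T) Finset.univ, single p.1 (1 : ℝ) := by
  rw [rowSymmetrizer, ← Finset.sum_filter]
  refine Finset.sum_subtype _ (fun p => ?_) _
  rw [Finset.mem_filter, mem_fiberPerm]
  exact ⟨fun h => ⟨fun x hx => absurd (Finset.mem_univ x) hx, h.2⟩,
    fun h => ⟨Finset.mem_univ _, h.2⟩⟩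

open scoped Classical in
lemma colAntisymmetrizer_eq (T : Fin n ≃ Y.cells) :
    colAntisymmetrizer T = ∑ p : fiberPerm (tabCol T) Finset.univ,
      single p.1 (((Perm.sign p.1 : ℤˣ) : ℤ) : ℝ) := by
  rw [colAntisymmetrizer, ← Finset.sum_filter]
  refine Finset.sum_subtype _ (fun p => ?_) _
  rw [Finset.mem_filter, mem_fiberPerm]
  exact ⟨fun h => ⟨fun x hx => absurd (Finset.mem_univ x) hx, h.2⟩,
    fun h => ⟨Finset.mem_univ _, h.2⟩⟩

lemma rowSymmetrizer_mul_single (T : Fin n ≃ Y.cells) {p : Perm (Fin n)}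
    (hp : p ∈ fiberPerm (tabRow T) Finset.univ) :
    rowSymmetrizer T * single p 1 = rowSymmetrizer T := by
  classical
  rw [rowSymmetrizer_eq, Finset.sum_mul]
  refine Fintype.sum_equiv (Equiv.mulRight (⟨p, hp⟩ : fiberPerm (tabRow T) Finset.univ)) _ _
    fun q => ?_
  simp [single_mul_single]

lemma single_mul_colAntisymmetrizer (T : Fin n ≃ Y.cells) {q : Perm (Fin n)}
    (hq : q ∈ fiberPerm (tabCol T) Finset.univ) :
    single q 1 * colAntisymmetrizer T
      = (((Perm.sign q : ℤˣ) : ℤ) : ℝ) • colAntisymmetrizer T := by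
  classical
  rw [colAntisymmetrizer_eq, Finset.mul_sum, Finset.smul_sum]
  refine Fintype.sum_equiv (Equiv.mulLeft (⟨q, hq⟩ : fiberPerm (tabCol T) Finset.univ)) _ _
    fun p => ?_
  rw [single_mul_single, smul_single, Equiv.coe_mulLeft, Subgroup.coe_mul, Perm.sign_mul]
  congr 1
  push_cast
  rw [one_mul, smul_eq_mul, ← mul_assoc, ← Int.cast_mul, ← Units.val_mul, Int.units_mul_self]
  simp

/-- A permutation under which two entries share a row of `T` and a column of `σT'` is killed by
the symmetrizers. -/
lemma rowSymmetrizer_mul_single_mul_eq_zero (T : Fin n ≃ Y.cells) (T' : Fin n ≃ Y'.cells)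
    (σ : Perm (Fin n)) (h : ¬ RowColDisjoint T (σ.symm.trans T')) :
    rowSymmetrizer T * single σ 1 * colAntisymmetrizer T' = 0 := by
  unfold RowColDisjoint at h
  push Not at h
  obtain ⟨a, b, hr, hc, hab⟩ := h
  have hp : swap a b ∈ fiberPerm (tabRow T) Finset.univ :=
    swap_mem_fiberPerm (Finset.mem_univ _) (Finset.mem_univ _) hr
  have hq : swap (σ.symm a) (σ.symm b) ∈ fiberPerm (tabCol T') Finset.univ :=
    swap_mem_fiberPerm (Finset.mem_univ _) (Finset.mem_univ _) hc
  -- The row symmetrizer absorbs the transposition on the left with sign +1, the column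
  -- antisymmetrizer its conjugate on the right with sign -1.
  have hs : swap a b * σ = σ * swap (σ.symm a) (σ.symm b) := by
    rw [Equiv.mul_swap_eq_swap_mul, apply_symm_apply, apply_symm_apply]
  have hne : σ.symm a ≠ σ.symm b := fun h => hab (σ.symm.injective h)
  have key : rowSymmetrizer T * single σ 1 * colAntisymmetrizer T'
      = -(rowSymmetrizer T * single σ 1 * colAntisymmetrizer T') := by
    conv_lhs => rw [← rowSymmetrizer_mul_single T hp]
    rw [mul_assoc (rowSymmetrizer T), single_mul_single, hs, one_mul, ← one_mul (1 : ℝ),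
      ← single_mul_single, one_mul, mul_assoc, mul_assoc (single σ (1 : ℝ)),
      single_mul_colAntisymmetrizer T' hq, Perm.sign_swap hne]
    simp [mul_assoc]
  have h2 : (2 : ℝ) • (rowSymmetrizer T * single σ 1 * colAntisymmetrizer T') = 0 := by
    rw [two_smul]
    nth_rewrite 1 [key]
    exact neg_add_cancel _
  exact (smul_eq_zero.1 h2).resolve_left two_ne_zero

/-- The Young symmetrizer of a filling. -/
noncomputable def youngSymmetrizer (T : Fin n ≃ Y.cells) : MonoidAlgebra ℝ (Perm (Fin n)) :=
  rowSymmetrizer T * colAntisymmetrizer T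

/-- By linearity `x` is a permutation. It is either killed or of the form row permutation times
column permutation, and then both factors are absorbed up to a sign. -/
lemma rowSymmetrizer_mul_mul_colAntisymmetrizer (T : Fin n ≃ Y.cells)
    (x : MonoidAlgebra ℝ (Perm (Fin n))) :
    ∃ c : ℝ, rowSymmetrizer T * x * colAntisymmetrizer T = c • youngSymmetrizer T := by
  induction x using MonoidAlgebra.induction_linear with
  | zero => exact ⟨0, by simp⟩
  | add x y hx hy =>
    obtain ⟨c, hc⟩ := hx
    obtain ⟨d, hd⟩ := hy
    exact ⟨c + d, by rw [mul_add, add_mul, hc, hd, add_smul]⟩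
  | single σ r =>
    have hr : single σ r = r • single σ (1 : ℝ) := by rw [smul_single, smul_eq_mul, mul_one]
    by_cases h : RowColDisjoint T (σ.symm.trans T)
    · obtain ⟨p, hp, q, hq, rfl⟩ := exists_row_mul_col T σ h
      refine ⟨r * (((Perm.sign q : ℤˣ) : ℤ) : ℝ), ?_⟩
      rw [hr, mul_smul_comm, smul_mul_assoc, ← one_mul (1 : ℝ), ← single_mul_single,
        ← mul_assoc, rowSymmetrizer_mul_single T hp, mul_assoc,
        single_mul_colAntisymmetrizer T hq, mul_smul_comm, smul_smul, youngSymmetrizer]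
    · refine ⟨0, ?_⟩
      rw [hr, mul_smul_comm, smul_mul_assoc, rowSymmetrizer_mul_single_mul_eq_zero T T σ h,
        smul_zero, zero_smul]

lemma rowSymmetrizer_mul_mul_eq_zero (T : Fin n ≃ Y.cells) (T' : Fin n ≃ Y'.cells)
    (h : ∀ σ : Perm (Fin n), ¬ RowColDisjoint T (σ.symm.trans T'))
    (x : MonoidAlgebra ℝ (Perm (Fin n))) :
    rowSymmetrizer T * x * colAntisymmetrizer T' = 0 := by
  induction x using MonoidAlgebra.induction_linear with
  | zero => simp
  | add x y hx hy => rw [mul_add, add_mul, hx, hy, add_zero]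
  | single σ r =>
    have hr : single σ r = r • single σ (1 : ℝ) := by rw [smul_single, smul_eq_mul, mul_one]
    rw [hr, mul_smul_comm, smul_mul_assoc, rowSymmetrizer_mul_single_mul_eq_zero T T' σ (h σ),
      smul_zero]

lemma youngSymmetrizer_mul_mul_self (T : Fin n ≃ Y.cells) (x : MonoidAlgebra ℝ (Perm (Fin n))) :
    ∃ c : ℝ, youngSymmetrizer T * x * youngSymmetrizer T = c • youngSymmetrizer T := by
  obtain ⟨c, hc⟩ := rowSymmetrizer_mul_mul_colAntisymmetrizer T
    (colAntisymmetrizer T * x * rowSymmetrizer T)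
  refine ⟨c, ?_⟩
  rw [← hc, youngSymmetrizer]
  simp only [mul_assoc]

lemma youngSymmetrizer_mul_mul_eq_zero (T : Fin n ≃ Y.cells) (T' : Fin n ≃ Y'.cells)
    (h : ∀ σ : Perm (Fin n), ¬ RowColDisjoint T (σ.symm.trans T'))
    (x : MonoidAlgebra ℝ (Perm (Fin n))) :
    youngSymmetrizer T * x * youngSymmetrizer T' = 0 := by
  have := rowSymmetrizer_mul_mul_eq_zero T T' h (colAntisymmetrizer T * x * rowSymmetrizer T')
  rw [← this, youngSymmetrizer, youngSymmetrizer]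
  simp only [mul_assoc]

/-- For different shapes one of the two products of Young symmetrizers vanishes. -/
lemma youngSymmetrizer_orthogonal (T : Fin n ≃ Y.cells) (T' : Fin n ≃ Y'.cells) (h : Y ≠ Y') :
    (∀ x, youngSymmetrizer T * x * youngSymmetrizer T' = 0) ∨
      ∀ x, youngSymmetrizer T' * x * youngSymmetrizer T = 0 := by
  by_cases h1 : ∀ σ : Perm (Fin n), ¬ RowColDisjoint T (σ.symm.trans T')
  · exact Or.inl (youngSymmetrizer_mul_mul_eq_zero T T' h1)
  -- A disjoint pair in each direction would give dominance both ways and hence equal shapes.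
  · refine Or.inr (youngSymmetrizer_mul_mul_eq_zero T' T fun σ h2 => ?_)
    push Not at h1
    obtain ⟨ρ, h1⟩ := h1
    exact h (eq_of_rowColDisjoint h1 h2)

open scoped Classical in
lemma youngSymmetrizer_eq_sum (T : Fin n ≃ Y.cells) :
    youngSymmetrizer T = ∑ p : fiberPerm (tabRow T) Finset.univ,
      ∑ q : fiberPerm (tabCol T) Finset.univ,
        single (p.1 * q.1) (((Perm.sign q.1 : ℤˣ) : ℤ) : ℝ) := by
  rw [youngSymmetrizer, rowSymmetrizer_eq, colAntisymmetrizer_eq, Finset.sum_mul_sum]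
  simp [single_mul_single]

lemma eq_one_of_row_mul_col_eq_one (T : Fin n ≃ Y.cells) {p q : Perm (Fin n)}
    (hp : p ∈ fiberPerm (tabRow T) Finset.univ) (hq : q ∈ fiberPerm (tabCol T) Finset.univ)
    (h : p * q = 1) : p = 1 ∧ q = 1 := by
  have hpq : p = q⁻¹ := mul_eq_one_iff_eq_inv.1 h
  have hp' : p ∈ fiberPerm (tabCol T) Finset.univ := hpq ▸ Subgroup.inv_mem _ hq
  have h1 : p = 1 := Equiv.ext fun a => tab_ext T (hp.2 a) (hp'.2 a)
  exact ⟨h1, by rw [h1, one_mul] at h; exact h⟩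

lemma youngSymmetrizer_coeff_one (T : Fin n ≃ Y.cells) :
    (youngSymmetrizer T).coeff 1 = 1 := by
  classical
  rw [youngSymmetrizer_eq_sum]
  simp only [coeff_sum, Finsupp.coe_finsetSum, Finset.sum_apply, coeff_single, Finsupp.single_apply]
  rw [Finset.sum_eq_single 1, Finset.sum_eq_single 1]
  · simp
  · intro q _ hq
    rw [if_neg]
    intro h
    exact hq (Subtype.ext (eq_one_of_row_mul_col_eq_one T (Subgroup.one_mem _) q.2 h).2)
  · simp
  · intro p _ hp
    refine Finset.sum_eq_zero fun q _ => ?_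
    rw [if_neg]
    intro h
    exact hp (Subtype.ext (eq_one_of_row_mul_col_eq_one T p.2 q.2 h).1)
  · simp

lemma youngSymmetrizer_ne_zero (T : Fin n ≃ Y.cells) : youngSymmetrizer T ≠ 0 := fun h => by
  have := youngSymmetrizer_coeff_one T
  rw [h] at this
  simp at this

/-- The Young symmetrizer is a nonzero multiple of an idempotent. -/
lemma exists_youngSymmetrizer_sq (T : Fin n ≃ Y.cells) :
    ∃ c : ℝ, c ≠ 0 ∧ youngSymmetrizer T * youngSymmetrizer T = c • youngSymmetrizer T := by
  obtain ⟨c, hc⟩ := youngSymmetrizer_mul_mul_self T 1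
  rw [mul_one] at hc
  refine ⟨c, ?_, hc⟩
  rintro rfl
  rw [zero_smul] at hc
  -- If the square vanished, right multiplication would be nilpotent with trace 0. But its trace is
  -- `n!`, because the coefficient of the identity is 1.
  have hnil : IsNilpotent (LinearMap.mulRight ℝ (youngSymmetrizer T)) :=
    ⟨2, by rw [LinearMap.pow_mulRight, sq, hc, LinearMap.mulRight_zero_eq_zero]⟩
  have h0 := (LinearMap.isNilpotent_trace_of_isNilpotent hnil).eq_zero
  rw [LinearMap.trace_eq_matrix_trace ℝ (MonoidAlgebra.basis (Perm (Fin n)) ℝ), Matrix.trace] at h0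
  have hd : ∀ σ : Perm (Fin n), (LinearMap.toMatrix (MonoidAlgebra.basis (Perm (Fin n)) ℝ)
      (MonoidAlgebra.basis (Perm (Fin n)) ℝ)
      (LinearMap.mulRight ℝ (youngSymmetrizer T))).diag σ = 1 := by
    intro σ
    rw [Matrix.diag_apply, LinearMap.toMatrix_apply, MonoidAlgebra.basis_apply,
      LinearMap.mulRight_apply]
    change (single σ 1 * youngSymmetrizer T).coeff σ = 1
    rw [coeff_single_mul_apply, inv_mul_cancel, youngSymmetrizer_coeff_one, one_mul]
  simp only [hd] at h0
  simp [Fintype.card_perm, Nat.factorial_ne_zero] at h0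

lemma mem_spechtModule {T : Fin n ≃ Y.cells} {x : MonoidAlgebra ℝ (Perm (Fin n))} :
    x ∈ spechtModule T ↔ ∃ y, y * youngSymmetrizer T = x := Ideal.mem_span_singleton'

/-- The generator of the Specht module. -/
noncomputable def spechtGen (T : Fin n ≃ Y.cells) : spechtModule T :=
  ⟨youngSymmetrizer T, Ideal.mem_span_singleton_self _⟩

lemma exists_smul_spechtGen (T : Fin n ≃ Y.cells) (v : spechtModule T) :
    ∃ y : MonoidAlgebra ℝ (Perm (Fin n)), v = y • spechtGen T := by
  obtain ⟨y, hy⟩ := mem_spechtModule.1 v.2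
  exact ⟨y, Subtype.ext hy.symm⟩

/-- With `e e = c e` one has `c f(e) = f(e e) = e f(e)`, and `f(e)` is a left multiple of `e'`.
Homomorphisms are thus controlled by the products `e x e'`, without using semisimplicity. -/
lemma specht_hom_gen (T : Fin n ≃ Y.cells) (T' : Fin n ≃ Y'.cells)
    (f : spechtModule T →ₗ[MonoidAlgebra ℝ (Perm (Fin n))] spechtModule T') :
    ∃ c : ℝ, c ≠ 0 ∧ ∃ x, c • (f (spechtGen T) : MonoidAlgebra ℝ (Perm (Fin n)))
      = youngSymmetrizer T * x * youngSymmetrizer T' := by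
  obtain ⟨c, hc, h⟩ := exists_youngSymmetrizer_sq T
  obtain ⟨x, hx⟩ := exists_smul_spechtGen T' (f (spechtGen T))
  refine ⟨c, hc, x, ?_⟩
  have h1 : youngSymmetrizer T • spechtGen T
      = (algebraMap ℝ (MonoidAlgebra ℝ (Perm (Fin n))) c) • spechtGen T :=
    Subtype.ext (by
      change youngSymmetrizer T * youngSymmetrizer T = algebraMap ℝ _ c * youngSymmetrizer T
      rw [h, Algebra.smul_def])
  have h2 := congrArg (fun v => (f v : MonoidAlgebra ℝ (Perm (Fin n)))) h1
  simp only [map_smul] at h2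
  have h3 : (f (spechtGen T) : MonoidAlgebra ℝ (Perm (Fin n))) = x * youngSymmetrizer T' := by
    rw [hx]; rfl
  rw [Algebra.smul_def]
  refine Eq.trans h2.symm ?_
  change youngSymmetrizer T * (f (spechtGen T) : MonoidAlgebra ℝ (Perm (Fin n))) = _
  rw [h3, mul_assoc]

lemma specht_hom_eq_zero (T : Fin n ≃ Y.cells) (T' : Fin n ≃ Y'.cells)
    (h : ∀ x, youngSymmetrizer T * x * youngSymmetrizer T' = 0)
    (f : spechtModule T →ₗ[MonoidAlgebra ℝ (Perm (Fin n))] spechtModule T') : f = 0 := by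
  obtain ⟨c, hc, x, hx⟩ := specht_hom_gen T T' f
  rw [h, smul_eq_zero] at hx
  have h0 : f (spechtGen T) = 0 := Subtype.ext (hx.resolve_left hc)
  refine LinearMap.ext fun v => ?_
  obtain ⟨y, rfl⟩ := exists_smul_spechtGen T v
  rw [map_smul, h0, smul_zero, LinearMap.zero_apply]

/-- Specht modules have only scalar endomorphisms. -/
lemma specht_end_eq_smul (T : Fin n ≃ Y.cells)
    (f : spechtModule T →ₗ[MonoidAlgebra ℝ (Perm (Fin n))] spechtModule T) :
    ∃ c : ℝ, ∀ v, f v = c • v := by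
  obtain ⟨c, hc, x, hx⟩ := specht_hom_gen T T f
  obtain ⟨d, hd⟩ := youngSymmetrizer_mul_mul_self T x
  have h0 : f (spechtGen T) = (c⁻¹ * d) • spechtGen T := Subtype.ext (by
    change (f (spechtGen T) : MonoidAlgebra ℝ (Perm (Fin n))) = (c⁻¹ * d) • youngSymmetrizer T
    rw [mul_smul, ← hd, ← hx, inv_smul_smul₀ hc])
  refine ⟨c⁻¹ * d, fun v => ?_⟩
  obtain ⟨y, rfl⟩ := exists_smul_spechtGen T v
  rw [map_smul, h0, smul_comm]

end Young

/-! ## Schur's lemma for the Young representations -/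

section Schur

open Equiv MonoidAlgebra

variable {n : ℕ} {Y Y' : YoungDiagram}

lemma YoungRep.D_inv (R : YoungRep n Y) (σ : Perm (Fin n)) : R.D σ⁻¹ = (R.D σ).transpose := by
  have h : R.D σ⁻¹ * R.D σ = 1 := by rw [← map_mul, inv_mul_cancel, map_one]
  exact left_inv_eq_right_inv h (R.orthogonal σ)

/-- The map of Specht modules defined by an intertwining matrix. -/
noncomputable def spechtHom {d d' : ℕ} {D : Perm (Fin n) →* Matrix (Fin d) (Fin d) ℝ}
    {D' : Perm (Fin n) →* Matrix (Fin d') (Fin d') ℝ} {T : Fin n ≃ Y.cells}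
    {T' : Fin n ≃ Y'.cells} (P : (Fin d → ℝ) ≃ₗ[ℝ] spechtModule T)
    (P' : (Fin d' → ℝ) ≃ₗ[ℝ] spechtModule T')
    (hP : ∀ σ v, (P ((D σ).mulVec v) : MonoidAlgebra ℝ (Perm (Fin n)))
      = single σ 1 * (P v : MonoidAlgebra ℝ (Perm (Fin n))))
    (hP' : ∀ σ v, (P' ((D' σ).mulVec v) : MonoidAlgebra ℝ (Perm (Fin n)))
      = single σ 1 * (P' v : MonoidAlgebra ℝ (Perm (Fin n))))
    (M : Matrix (Fin d) (Fin d') ℝ) (hM : ∀ σ, D σ * M = M * D' σ) :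
    spechtModule T' →ₗ[MonoidAlgebra ℝ (Perm (Fin n))] spechtModule T :=
  equivariantOfLinearOfComm (P.toLinearMap ∘ₗ M.mulVecLin ∘ₗ P'.symm.toLinearMap) fun σ v => by
    obtain ⟨w, rfl⟩ := P'.surjective v
    have h1 : single σ (1 : ℝ) • P' w = P' ((D' σ).mulVec w) := Subtype.ext (hP' σ w).symm
    have h2 : ∀ u, single σ (1 : ℝ) • P u = P ((D σ).mulVec u) := fun u =>
      Subtype.ext (hP σ u).symm
    rw [h1]
    simp only [LinearMap.comp_apply, LinearEquiv.coe_coe, LinearEquiv.symm_apply_apply,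
      Matrix.mulVecLin_apply, h2, Matrix.mulVec_mulVec, hM]

lemma spechtHom_apply {d d' : ℕ} {D : Perm (Fin n) →* Matrix (Fin d) (Fin d) ℝ}
    {D' : Perm (Fin n) →* Matrix (Fin d') (Fin d') ℝ} {T : Fin n ≃ Y.cells}
    {T' : Fin n ≃ Y'.cells} (P : (Fin d → ℝ) ≃ₗ[ℝ] spechtModule T)
    (P' : (Fin d' → ℝ) ≃ₗ[ℝ] spechtModule T')
    (hP : ∀ σ v, (P ((D σ).mulVec v) : MonoidAlgebra ℝ (Perm (Fin n)))
      = single σ 1 * (P v : MonoidAlgebra ℝ (Perm (Fin n))))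
    (hP' : ∀ σ v, (P' ((D' σ).mulVec v) : MonoidAlgebra ℝ (Perm (Fin n)))
      = single σ 1 * (P' v : MonoidAlgebra ℝ (Perm (Fin n))))
    (M : Matrix (Fin d) (Fin d') ℝ) (hM : ∀ σ, D σ * M = M * D' σ) (w : Fin d' → ℝ) :
    spechtHom P P' hP hP' M hM (P' w) = P (M.mulVec w) := by
  simp [spechtHom, equivariantOfLinearOfComm_apply]

/-- Matrices which intertwine Young representations of different shapes vanish. -/
lemma YoungRep.intertwiner_eq_zero (R : YoungRep n Y) (R' : YoungRep n Y') (hY : Y ≠ Y')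
    (M : Matrix (Fin R.d) (Fin R'.d) ℝ) (hM : ∀ σ, R.D σ * M = M * R'.D σ) : M = 0 := by
  obtain ⟨T, P, hP⟩ := R.affords
  obtain ⟨T', P', hP'⟩ := R'.affords
  rcases youngSymmetrizer_orthogonal T T' hY with h | h
  -- The vanishing is known in one direction only. If it is the wrong one for `M`, orthogonality of
  -- the matrices allows passing to the transpose.
  · have hM' : ∀ σ, R'.D σ * M.transpose = M.transpose * R.D σ := fun σ => by
      have := congrArg Matrix.transpose (hM σ⁻¹)
      rw [Matrix.transpose_mul, Matrix.transpose_mul, D_inv, D_inv, Matrix.transpose_transpose,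
        Matrix.transpose_transpose] at this
      exact this.symm
    have h0 := specht_hom_eq_zero T T' h (spechtHom P' P hP' hP M.transpose hM')
    rw [← Matrix.transpose_eq_zero, Matrix.ext_iff_mulVec]
    intro w
    have := spechtHom_apply P' P hP' hP M.transpose hM' w
    rw [h0, LinearMap.zero_apply, eq_comm, LinearEquiv.map_eq_zero_iff] at this
    rw [this, Matrix.zero_mulVec]
  · have h0 := specht_hom_eq_zero T' T h (spechtHom P P' hP hP' M hM)
    rw [Matrix.ext_iff_mulVec]
    intro w
    have := spechtHom_apply P P' hP hP' M hM w
    rw [h0, LinearMap.zero_apply, eq_comm, LinearEquiv.map_eq_zero_iff] at this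
    rw [this, Matrix.zero_mulVec]

/-- Matrices which commute with a Young representation are scalar. -/
lemma YoungRep.exists_eq_smul_one (R : YoungRep n Y) (M : Matrix (Fin R.d) (Fin R.d) ℝ)
    (hM : ∀ σ, R.D σ * M = M * R.D σ) : ∃ c : ℝ, M = c • 1 := by
  obtain ⟨T, P, hP⟩ := R.affords
  obtain ⟨c, hc⟩ := specht_end_eq_smul T (spechtHom P P hP hP M hM)
  refine ⟨c, ?_⟩
  rw [Matrix.ext_iff_mulVec]
  intro w
  have := spechtHom_apply P P hP hP M hM w
  rw [hc, ← map_smul] at this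
  rw [← P.injective this, Matrix.smul_mulVec, Matrix.one_mulVec]

lemma YoungRep.average_comm (R : YoungRep n Y) (R' : YoungRep n Y')
    (X : Matrix (Fin R.d) (Fin R'.d) ℝ) (ρ : Perm (Fin n)) :
    R.D ρ * ∑ σ, R.D σ * X * (R'.D σ).transpose
      = (∑ σ, R.D σ * X * (R'.D σ).transpose) * R'.D ρ := by
  rw [Matrix.mul_sum, Matrix.sum_mul]
  refine Fintype.sum_equiv (Equiv.mulLeft ρ) _ _ fun σ => ?_
  rw [Equiv.coe_mulLeft, ← D_inv, ← D_inv, mul_inv_rev, map_mul, map_mul]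
  have : R'.D ρ⁻¹ * R'.D ρ = 1 := by rw [← map_mul, inv_mul_cancel, map_one]
  simp only [Matrix.mul_assoc, this, Matrix.mul_one]

/-- Averaging an elementary matrix turns Schur's lemma into a statement on matrix coefficients. -/
lemma YoungRep.average_apply (R : YoungRep n Y) (R' : YoungRep n Y') (α β : Fin R.d)
    (μ ν : Fin R'.d) :
    (∑ σ, R.D σ * Matrix.single β ν (1 : ℝ) * (R'.D σ).transpose : Matrix _ _ ℝ) α μ
      = ∑ σ, R.D σ α β * R'.D σ μ ν := by
  rw [Matrix.sum_apply]
  refine Finset.sum_congr rfl fun σ _ => ?_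
  rw [Matrix.mul_apply, Finset.sum_eq_single ν]
  · simp
  · intro κ _ hκ
    rw [Matrix.mul_single_apply_of_ne _ _ _ _ _ hκ, zero_mul]
  · simp

/-- Schur orthogonality for different shapes. -/
lemma YoungRep.sum_mul_eq_zero (R : YoungRep n Y) (R' : YoungRep n Y') (hY : Y ≠ Y')
    (α β : Fin R.d) (μ ν : Fin R'.d) : ∑ σ, R.D σ α β * R'.D σ μ ν = 0 := by
  rw [← average_apply, intertwiner_eq_zero R R' hY _ (average_comm R R' _), Matrix.zero_apply]

/-- Schur orthogonality for a single shape. -/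
lemma YoungRep.sum_mul_self (R : YoungRep n Y) (α β μ ν : Fin R.d) :
    ∑ σ, R.D σ α β * R.D σ μ ν
      = if α = μ ∧ β = ν then (n.factorial : ℝ) / (R.d : ℝ) else 0 := by
  obtain ⟨c, hc⟩ := exists_eq_smul_one R _ (average_comm R R (Matrix.single β ν (1 : ℝ)))
  have hd : (R.d : ℝ) ≠ 0 := Nat.cast_ne_zero.2 (Nat.pos_iff_ne_zero.1 α.pos)
  have ht := congrArg Matrix.trace hc
  rw [Matrix.trace_sum, Matrix.trace_smul, Matrix.trace_one, Fintype.card_fin] at ht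
  have h1 : ∀ σ, (R.D σ * Matrix.single β ν (1 : ℝ) * (R.D σ).transpose).trace
      = if β = ν then 1 else 0 := by
    intro σ
    rw [Matrix.trace_mul_comm, ← Matrix.mul_assoc, ← R.D_inv, ← map_mul, inv_mul_cancel, map_one,
      Matrix.one_mul]
    split_ifs with h
    · subst h; exact Matrix.trace_single_eq_same _ _
    · exact Matrix.trace_single_eq_of_ne _ _ _ h
  rw [Finset.sum_congr rfl fun σ _ => h1 σ, Finset.sum_const, Finset.card_univ, Fintype.card_perm,
    Fintype.card_fin, nsmul_eq_mul, smul_eq_mul] at ht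
  rw [← average_apply, hc, Matrix.smul_apply, Matrix.one_apply, smul_eq_mul]
  by_cases hβ : β = ν
  · rw [if_pos hβ, mul_one] at ht
    rw [ht, mul_div_assoc, div_self hd]
    simp [hβ]
  · rw [if_neg hβ, mul_zero, eq_comm, mul_eq_zero, or_iff_left hd] at ht
    simp [hβ, ht]

open scoped Classical in
/-- A real class function acts in a Young representation by a scalar. -/
lemma YoungRep.sum_class_smul (R : YoungRep n Y) {T : Fin n ≃ Y.cells}
    (P : (Fin R.d → ℝ) ≃ₗ[ℝ] spechtModule T)
    (hP : ∀ σ v, (P ((R.D σ).mulVec v) : MonoidAlgebra ℝ (Perm (Fin n)))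
      = single σ 1 * (P v : MonoidAlgebra ℝ (Perm (Fin n))))
    (h : Perm (Fin n) → ℝ) (hh : ∀ ρ σ, h (ρ * σ * ρ⁻¹) = h σ) :
    ∑ σ, h σ • R.D σ = (∑ p : fiberPerm (tabRow T) Finset.univ,
      ∑ q : fiberPerm (tabCol T) Finset.univ,
        ((Perm.sign q.1 : ℤ) : ℝ) * h (p.1 * q.1)⁻¹) • 1 := by
  obtain ⟨c, hc⟩ := R.exists_eq_smul_one (∑ σ, h σ • R.D σ) fun ρ => by
    rw [Finset.mul_sum, Finset.sum_mul]
    refine Fintype.sum_equiv (MulAut.conj ρ).toEquiv _ _ fun σ => ?_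
    change _ = h (ρ * σ * ρ⁻¹) • R.D (ρ * σ * ρ⁻¹) * R.D ρ
    rw [hh, Matrix.mul_smul, Matrix.smul_mul, ← map_mul, ← map_mul, inv_mul_cancel_right]
  rw [hc]
  congr 1
  -- The scalar is found by acting on the Young symmetrizer and reading the coefficient of the
  -- identity, which is 1 in the symmetrizer itself.
  obtain ⟨v, hv⟩ := P.surjective (spechtGen T)
  have h1 : P ((∑ σ, h σ • R.D σ).mulVec v) = c • spechtGen T := by
    rw [hc, Matrix.smul_mulVec, Matrix.one_mulVec, map_smul, hv]
  rw [Matrix.sum_mulVec, map_sum] at h1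
  have h2 := congrArg (fun w : spechtModule T =>
    (w : MonoidAlgebra ℝ (Perm (Fin n))).coeff 1) h1
  have h3 : ((c • spechtGen T : spechtModule T) : MonoidAlgebra ℝ (Perm (Fin n))).coeff 1 = c := by
    change (c • youngSymmetrizer T).coeff 1 = c
    rw [coeff_smul_apply, youngSymmetrizer_coeff_one, smul_eq_mul, mul_one]
  simp only [h3] at h2
  rw [← h2, Submodule.coe_sum, coeff_sum, Finsupp.coe_finsetSum, Finset.sum_apply]
  have h4 : ∀ σ, (P ((h σ • R.D σ).mulVec v) : MonoidAlgebra ℝ (Perm (Fin n))).coeff 1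
      = ∑ p : fiberPerm (tabRow T) Finset.univ, ∑ q : fiberPerm (tabCol T) Finset.univ,
        if σ = (p.1 * q.1)⁻¹ then ((Perm.sign q.1 : ℤ) : ℝ) * h (p.1 * q.1)⁻¹ else 0 := by
    intro σ
    rw [Matrix.smul_mulVec, map_smul]
    change (h σ • (P ((R.D σ).mulVec v) : MonoidAlgebra ℝ (Perm (Fin n)))).coeff 1 = _
    rw [hP, hv]
    change (h σ • (single σ 1 * youngSymmetrizer T)).coeff 1 = _
    rw [youngSymmetrizer_eq_sum]
    simp only [Finset.mul_sum, single_mul_single, coeff_smul_apply, coeff_sum,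
      Finsupp.coe_finsetSum, Finset.sum_apply, coeff_single, Finsupp.single_apply, smul_eq_mul,
      one_mul, ← eq_inv_iff_mul_eq_one]
    refine Finset.sum_congr rfl fun p _ => Finset.sum_congr rfl fun q _ => ?_
    split_ifs with hσ
    · rw [← hσ, mul_comm]
    · rw [mul_zero]
  rw [Finset.sum_congr rfl fun σ _ => h4 σ, Finset.sum_comm]
  refine Finset.sum_congr rfl fun p _ => ?_
  rw [Finset.sum_comm]
  refine Finset.sum_congr rfl fun q _ => ?_
  simp

lemma contentProd_eq (C : ℂ) (T : Fin n ≃ Y.cells) :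
    contentProd C Y = ∏ a, (C - ((tabCol T a : ℂ) - (tabRow T a : ℂ))) := by
  rw [contentProd, ← Finset.prod_coe_sort]
  exact (Equiv.prod_comp T fun b : Y.cells => (C - ((b.1.2 : ℂ) - (b.1.1 : ℂ)))).symm

/-- The Gram operator `∑ sgn(σ) C^{cyc(σ)} σ` acts in a Young representation by the content
product. -/
theorem YoungRep.sum_sign_pow_cycleCount (R : YoungRep n Y) (C : ℂ) (α β : Fin R.d) :
    ∑ σ : Perm (Fin n), ((Perm.sign σ : ℤ) : ℂ) * C ^ cycleCount n σ * (R.D σ α β : ℂ)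
      = if α = β then contentProd C Y else 0 := by
  classical
  obtain ⟨T, P, hP⟩ := R.affords
  set g : Perm (Fin n) → ℂ := fun σ => ((Perm.sign σ : ℤ) : ℂ) * C ^ cycleCount n σ with hg
  have hgc : ∀ ρ σ, g (ρ * σ * ρ⁻¹) = g σ := fun ρ σ => by
    simp only [hg]
    rw [cycleCount_mul_comm, ← mul_assoc, inv_mul_cancel, one_mul, Perm.sign_mul, Perm.sign_mul,
      Perm.sign_inv, mul_right_comm, Int.units_mul_self, one_mul]
  have key : ∀ h : Perm (Fin n) → ℝ, (∀ ρ σ, h (ρ * σ * ρ⁻¹) = h σ) →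
      ∑ σ, h σ * R.D σ α β = if α = β then ∑ p : fiberPerm (tabRow T) Finset.univ,
        ∑ q : fiberPerm (tabCol T) Finset.univ,
          ((Perm.sign q.1 : ℤ) : ℝ) * h (p.1 * q.1)⁻¹ else 0 := by
    intro h hh
    have := congrFun (congrFun (R.sum_class_smul P hP h hh) α) β
    rw [Matrix.sum_apply] at this
    simpa [Matrix.one_apply] using this
  -- The representation is real and `C` is complex, so real and imaginary parts are treated
  -- separately.
  have hre := key (fun σ => (g σ).re) fun ρ σ => by simp only [hgc]
  have him := key (fun σ => (g σ).im) fun ρ σ => by simp only [hgc]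
  have hcomplex : ∑ σ, g σ * (R.D σ α β : ℂ)
      = if α = β then ∑ p : fiberPerm (tabRow T) Finset.univ,
        ∑ q : fiberPerm (tabCol T) Finset.univ,
          ((Perm.sign q.1 : ℤ) : ℂ) * g (p.1 * q.1)⁻¹ else 0 := by
    apply Complex.ext
    · rw [Complex.re_sum]
      simp only [Complex.re_mul_ofReal, hre]
      split_ifs
      · simp only [Complex.re_sum, ← Complex.ofReal_intCast, Complex.re_ofReal_mul]
      · rfl
    · rw [Complex.im_sum]
      simp only [Complex.im_mul_ofReal, him]
      split_ifs
      · simp only [Complex.im_sum, ← Complex.ofReal_intCast, Complex.im_ofReal_mul]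
      · rfl
  rw [hcomplex]
  congr 1
  have hprod := rowColSum_eq_prod C (tabRow T) (tabCol T) (fun x y => tab_ext T) Finset.univ
    (by
      intro x _ a ha b hb
      obtain ⟨y, h1, h2⟩ := exists_tab T (Y.up_left_mem ha hb (tab_mem T x))
      exact ⟨y, Finset.mem_univ _, h1, h2⟩)
  rw [contentProd_eq C T, ← hprod, rowColSum, Finset.card_univ, Fintype.card_fin]
  refine Finset.sum_congr rfl fun p _ => Finset.sum_congr rfl fun q _ => ?_
  simp only [hg]
  -- The signs of `q` and of `pq` multiply to that of `p`, which is the sign used in `rowColSum`.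
  rw [cycleCount_inv, Perm.sign_inv, Perm.sign_mul, ← mul_assoc, ← Int.cast_mul, ← Units.val_mul,
    mul_comm (Perm.sign p.1), ← mul_assoc, Int.units_mul_self, one_mul]

end Schur

/-! ## Completeness of the Young representations -/

section Completeness

open Equiv

lemma YoungDiagram.card_cellsOfRowLens (w : List ℕ) :
    (YoungDiagram.cellsOfRowLens w).card = w.sum := by
  induction w with
  | nil => rfl
  | cons a w ih =>
    rw [YoungDiagram.cellsOfRowLens, Finset.card_union_of_disjoint, Finset.card_map, ih]
    · simp
    · rw [Finset.disjoint_left]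
      rintro ⟨r, c⟩ h1 h2
      rw [Finset.mem_product, Finset.mem_singleton] at h1
      obtain ⟨⟨x, y⟩, _, h⟩ := Finset.mem_map.1 h2
      have := congrArg Prod.fst h
      simp only [Function.Embedding.coe_prodMap, Prod.map_apply,
        Function.Embedding.coeFn_mk] at this
      exact absurd (this.trans h1.1) (Nat.succ_ne_zero x)

/-- The Young diagram whose row lengths are the parts of a multiset. -/
noncomputable def diagramOfParts (s : Multiset ℕ) : YoungDiagram :=
  YoungDiagram.ofRowLens (s.sort (· ≥ ·)) (Multiset.pairwise_sort s (· ≥ ·)).sortedGE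

lemma card_diagramOfParts (s : Multiset ℕ) : (diagramOfParts s).card = s.sum := by
  change (YoungDiagram.cellsOfRowLens _).card = _
  rw [YoungDiagram.card_cellsOfRowLens, ← Multiset.sum_coe, Multiset.sort_eq]

lemma diagramOfParts_inj {s t : Multiset ℕ} (hs : ∀ x ∈ s, 0 < x) (ht : ∀ x ∈ t, 0 < x)
    (h : diagramOfParts s = diagramOfParts t) : s = t := by
  have := congrArg YoungDiagram.rowLens h
  rw [diagramOfParts, diagramOfParts,
    YoungDiagram.rowLens_ofRowLens_eq_self (fun x hx => hs x ((Multiset.mem_sort _).1 hx)),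
    YoungDiagram.rowLens_ofRowLens_eq_self (fun x hx => ht x ((Multiset.mem_sort _).1 hx))] at this
  rw [← Multiset.sort_eq s (· ≥ ·), this, Multiset.sort_eq]

/-- The Young diagram of the cycle type of a permutation. -/
noncomputable def cycleDiagram {n : ℕ} (σ : Perm (Fin n)) : DiagramOfSize n :=
  ⟨diagramOfParts σ.partition.parts, by
    rw [card_diagramOfParts, σ.partition.parts_sum, Fintype.card_fin]⟩

lemma isConj_of_cycleDiagram_eq {n : ℕ} {σ ρ : Perm (Fin n)}
    (h : cycleDiagram σ = cycleDiagram ρ) : IsConj σ ρ := by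
  rw [Perm.partition_eq_of_isConj]
  exact Nat.Partition.ext (diagramOfParts_inj (fun _ => σ.partition.parts_pos)
    (fun _ => ρ.partition.parts_pos) (congrArg Subtype.val h))

variable {n : ℕ}

lemma YoungRep.trace_eq_of_isConj {Y : YoungDiagram} (R : YoungRep n Y) {σ ρ : Perm (Fin n)}
    (h : IsConj σ ρ) : (R.D σ).trace = (R.D ρ).trace := by
  obtain ⟨c, rfl⟩ := isConj_iff.1 h
  rw [map_mul, Matrix.trace_mul_comm, ← map_mul, ← mul_assoc, inv_mul_cancel, one_mul]

lemma YoungRep.d_ne_zero {Y : YoungDiagram} (R : YoungRep n Y) : (R.d : ℝ) ≠ 0 := by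
  intro h
  rw [Nat.cast_eq_zero] at h
  obtain ⟨T, P, -⟩ := R.affords
  have : IsEmpty (Fin R.d) := by rw [h]; exact Fin.isEmpty
  have h0 : spechtGen T = 0 := by
    rw [← P.apply_symm_apply (spechtGen T), Subsingleton.elim (P.symm (spechtGen T)) 0, map_zero]
  exact youngSymmetrizer_ne_zero T (congrArg Subtype.val h0)

lemma YoungRep.sum_trace_mul_trace (R : ∀ Y : DiagramOfSize n, YoungRep n Y.1)
    (Y Z : DiagramOfSize n) [Decidable (Y = Z)] :
    ∑ σ, ((R Y).D σ).trace * ((R Z).D σ).trace = if Y = Z then (n.factorial : ℝ) else 0 := by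
  simp only [Matrix.trace, Matrix.diag_apply, Finset.sum_mul_sum]
  rw [Finset.sum_comm]
  split_ifs with h
  · subst h
    have : ∀ α, ∑ σ, ∑ μ, (R Y).D σ α α * (R Y).D σ μ μ
        = (n.factorial : ℝ) / ((R Y).d : ℝ) := by
      intro α
      rw [Finset.sum_comm]
      simp [(R Y).sum_mul_self]
    rw [Finset.sum_congr rfl fun α _ => this α, Finset.sum_const, Finset.card_univ,
      Fintype.card_fin, nsmul_eq_mul, mul_div_cancel₀ _ (R Y).d_ne_zero]
  · refine Finset.sum_eq_zero fun α _ => ?_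
    rw [Finset.sum_comm]
    exact Finset.sum_eq_zero fun μ _ =>
      (R Y).sum_mul_eq_zero (R Z) (fun h' => h (Subtype.ext h')) _ _ _ _

/-- The characters, as functions on the conjugacy classes. -/
noncomputable def classCharacter (R : ∀ Y : DiagramOfSize n, YoungRep n Y.1)
    (Y : DiagramOfSize n) (k : ConjClasses (Perm (Fin n))) : ℝ :=
  ((R Y).D (Quotient.out k)).trace

lemma classCharacter_mk (R : ∀ Y : DiagramOfSize n, YoungRep n Y.1) (Y : DiagramOfSize n)
    (σ : Perm (Fin n)) : classCharacter R Y (ConjClasses.mk σ) = ((R Y).D σ).trace :=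
  (R Y).trace_eq_of_isConj (Quotient.mk_out (s := IsConj.setoid _) σ)

lemma classCharacter_linearIndependent (R : ∀ Y : DiagramOfSize n, YoungRep n Y.1) :
    LinearIndependent ℝ (classCharacter R) := by
  classical
  rw [linearIndependent_iff']
  intro s g hg Z hZ
  have h1 : ∀ σ, ∑ Y ∈ s, g Y * ((R Y).D σ).trace = 0 := by
    intro σ
    have := congrFun hg (ConjClasses.mk σ)
    simpa [classCharacter_mk] using this
  have h2 : ∑ σ, (∑ Y ∈ s, g Y * ((R Y).D σ).trace) * ((R Z).D σ).trace = 0 := by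
    simp [h1]
  simp only [Finset.sum_mul, mul_assoc] at h2
  rw [Finset.sum_comm] at h2
  simp only [← Finset.mul_sum, YoungRep.sum_trace_mul_trace] at h2
  simpa [hZ, Nat.factorial_ne_zero] using h2

/-- An independent family in a finite-dimensional space is finite. -/
lemma finite_diagramOfSize (R : ∀ Y : DiagramOfSize n, YoungRep n Y.1) :
    Finite (DiagramOfSize n) := by
  classical
  exact (classCharacter_linearIndependent R).finite

/-- The delta function at the identity is a combination of characters. -/
lemma exists_sum_trace_eq_delta [Fintype (DiagramOfSize n)]
    (R : ∀ Y : DiagramOfSize n, YoungRep n Y.1) :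
    ∃ c : DiagramOfSize n → ℝ, ∀ σ : Perm (Fin n),
      ∑ Y, c Y * ((R Y).D σ).trace = if σ = 1 then 1 else 0 := by
  classical
  have hli := classCharacter_linearIndependent R
  have hcard : Fintype.card (DiagramOfSize n)
      = Module.finrank ℝ (ConjClasses (Perm (Fin n)) → ℝ) := by
    -- Independence bounds the number of diagrams above by that of conjugacy classes; the cycle type
    -- gives the opposite bound.
    refine le_antisymm hli.fintype_card_le_finrank ?_
    rw [Module.finrank_fintype_fun_eq_card]
    refine Fintype.card_le_of_injective (fun k => cycleDiagram (Quotient.out k)) fun k l h => ?_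
    rw [← Quotient.out_eq k, ← Quotient.out_eq l]
    exact Quotient.sound (isConj_of_cycleDiagram_eq h)
  have htop := hli.span_eq_top_of_card_eq_finrank' hcard
  have hmem : (Pi.single (ConjClasses.mk 1) 1 : ConjClasses (Perm (Fin n)) → ℝ)
      ∈ Submodule.span ℝ (Set.range (classCharacter R)) := by rw [htop]; trivial
  obtain ⟨c, hc⟩ := (Submodule.mem_span_range_iff_exists_fun ℝ).1 hmem
  refine ⟨c, fun σ => ?_⟩
  have := congrFun hc (ConjClasses.mk σ)
  rw [Finset.sum_apply] at this
  simp only [Pi.smul_apply, classCharacter_mk, smul_eq_mul] at this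
  rw [this, Pi.single_apply]
  refine if_congr ?_ rfl rfl
  rw [ConjClasses.mk_eq_mk_iff_isConj, isConj_comm, isConj_one_right]

end Completeness

/-! ## The Young basis -/

section YoungBasis

open Equiv

variable {n : ℕ}

/-- The coefficients of `|Y;αβ⟩` in the permuted states. -/
noncomputable def youngCoeff {Y : YoungDiagram} (R : YoungRep n Y) (α β : Fin R.d)
    (σ : Perm (Fin n)) : ℂ :=
  (R.d : ℂ) / (n.factorial : ℂ) * (R.D σ α β : ℂ)

lemma youngKet_eq (C : ℂ) (i j : Fin n → ℤ) {Y : YoungDiagram} (R : YoungRep n Y)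
    (α β : Fin R.d) :
    youngKet C i j R α β = Fintype.linearCombination ℂ (permState C i j) (youngCoeff R α β) := by
  rw [Fintype.linearCombination_apply]
  refine (Finset.smul_sum (r := (R.d : ℂ) / (n.factorial : ℂ)) (s := Finset.univ)
    (f := fun σ => ((R.D σ α β : ℝ) : ℂ) • permState C i j σ)).trans ?_
  refine Finset.sum_congr rfl fun σ _ => ?_
  rw [youngCoeff, mul_smul]

lemma sum_youngCoeff_mul (R : ∀ Y : DiagramOfSize n, YoungRep n Y.1)
    (x y : Σ Y : DiagramOfSize n, Fin (R Y).d × Fin (R Y).d) [Decidable (x = y)] :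
    ∑ σ, youngCoeff (R x.1) x.2.1 x.2.2 σ * ((R y.1).D σ y.2.1 y.2.2 : ℂ)
      = if x = y then 1 else 0 := by
  obtain ⟨Y, α, β⟩ := x
  obtain ⟨Z, μ, ν⟩ := y
  simp only [youngCoeff, mul_assoc, ← Finset.mul_sum, ← Complex.ofReal_mul, ← Complex.ofReal_sum]
  by_cases h : Y = Z
  · subst h
    have hd : ((R Y).d : ℂ) ≠ 0 := by exact_mod_cast (R Y).d_ne_zero
    have hn : (n.factorial : ℂ) ≠ 0 := by exact_mod_cast n.factorial_ne_zero
    rw [(R Y).sum_mul_self]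
    simp only [Sigma.mk.injEq, heq_eq_eq, true_and, Prod.mk.injEq]
    split_ifs
    · push_cast; field_simp
    · simp
  · rw [(R Y).sum_mul_eq_zero (R Z) (fun h' => h (Subtype.ext h')), if_neg]
    · simp
    · exact fun h' => h (congrArg Sigma.fst h')

lemma youngCoeff_linearIndependent (R : ∀ Y : DiagramOfSize n, YoungRep n Y.1) :
    LinearIndependent ℂ (fun x : Σ Y : DiagramOfSize n, Fin (R Y).d × Fin (R Y).d =>
      youngCoeff (R x.1) x.2.1 x.2.2) := by
  classical
  rw [linearIndependent_iff']
  intro s g hg y hy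
  have h1 : ∀ σ, ∑ x ∈ s, g x * youngCoeff (R x.1) x.2.1 x.2.2 σ = 0 := fun σ => by
    simpa using congrFun hg σ
  have h2 : ∑ σ, (∑ x ∈ s, g x * youngCoeff (R x.1) x.2.1 x.2.2 σ)
      * ((R y.1).D σ y.2.1 y.2.2 : ℂ) = 0 := by simp [h1]
  simp only [Finset.sum_mul, mul_assoc] at h2
  rw [Finset.sum_comm] at h2
  simp only [← Finset.mul_sum, sum_youngCoeff_mul] at h2
  simpa [hy] using h2

theorem youngKet_linearIndependent (C : ℂ) (R : ∀ Y : DiagramOfSize n, YoungRep n Y.1)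
    (i j : Fin n → ℤ) (hi : Function.Injective i) (hj : Function.Injective j)
    (hi' : ∀ a, 0 < i a) (hj' : ∀ a, 0 ≤ j a) :
    LinearIndependent ℂ (fun x : Σ Y : DiagramOfSize n, Fin (R Y).d × Fin (R Y).d =>
      youngKet C i j (R x.1) x.2.1 x.2.2) := by
  have h := (youngCoeff_linearIndependent R).map'
    (Fintype.linearCombination ℂ (permState C i j))
    (LinearMap.ker_eq_bot.2
      (permState_linearIndependent C i j hi hj hi' hj').fintypeLinearCombination_injective)
  simp only [youngKet_eq]
  exact h

theorem span_youngKet (C : ℂ) (R : ∀ Y : DiagramOfSize n, YoungRep n Y.1) (i j : Fin n → ℤ) :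
    Submodule.span ℂ (Set.range fun x : Σ Y : DiagramOfSize n, Fin (R Y).d × Fin (R Y).d =>
      youngKet C i j (R x.1) x.2.1 x.2.2) = Submodule.span ℂ (Set.range (permState C i j)) := by
  refine le_antisymm (Submodule.span_le.2 ?_) (Submodule.span_le.2 ?_)
  · rintro _ ⟨x, rfl⟩
    exact Submodule.smul_mem _ _ (Submodule.sum_mem _ fun σ _ =>
      Submodule.smul_mem _ _ (Submodule.subset_span ⟨σ, rfl⟩))
  · rintro _ ⟨σ, rfl⟩
    have := finite_diagramOfSize R
    have : Fintype (DiagramOfSize n) := Fintype.ofFinite _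
    obtain ⟨c, hc⟩ := exists_sum_trace_eq_delta R
    have hn : (n.factorial : ℂ) ≠ 0 := by exact_mod_cast n.factorial_ne_zero
    -- The delta function at `σ` is the delta function at 1 evaluated at `σ⁻¹ρ`; expanding the trace
    -- of `D(σ⁻¹)D(ρ)` gives matrix coefficients of `ρ`.
    have hcoeff : Pi.single σ (1 : ℂ) = ∑ Y, ∑ α, ∑ β,
        ((c Y * (R Y).D σ⁻¹ α β : ℝ) * ((n.factorial : ℂ) / ((R Y).d : ℂ)))
          • youngCoeff (R Y) β α := by
      funext ρ
      have h1 := congrArg (fun r : ℝ => (r : ℂ)) (hc (σ⁻¹ * ρ))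
      simp only [map_mul, Matrix.trace, Matrix.diag_apply, Matrix.mul_apply, Finset.mul_sum] at h1
      have h2 : (if σ⁻¹ * ρ = 1 then (1 : ℝ) else 0) = if ρ = σ then 1 else 0 :=
        if_congr (by rw [inv_mul_eq_one, eq_comm]) rfl rfl
      rw [h2] at h1
      have h3 : (Pi.single σ (1 : ℂ) : Perm (Fin n) → ℂ) ρ
          = (((if ρ = σ then 1 else 0 : ℝ)) : ℂ) := by
        rw [Pi.single_apply]; split_ifs <;> simp
      rw [h3, ← h1]
      simp only [Finset.sum_apply, Pi.smul_apply, youngCoeff, smul_eq_mul]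
      push_cast
      refine Finset.sum_congr rfl fun Y _ => Finset.sum_congr rfl fun α _ =>
        Finset.sum_congr rfl fun β _ => ?_
      have hd : ((R Y).d : ℂ) ≠ 0 := by exact_mod_cast (R Y).d_ne_zero
      field_simp
    have hs : permState C i j σ
        = Fintype.linearCombination ℂ (permState C i j) (Pi.single σ (1 : ℂ)) := by
      rw [Fintype.linearCombination_apply_single, one_smul]
    rw [hs, hcoeff]
    simp only [map_sum, map_smul, ← youngKet_eq]
    exact Submodule.sum_mem _ fun Y _ => Submodule.sum_mem _ fun α _ =>
      Submodule.sum_mem _ fun β _ => Submodule.smul_mem _ _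
        (Submodule.subset_span ⟨⟨Y, β, α⟩, rfl⟩)

lemma vermaForm_youngKet (C : ℂ) (τ : ℂ →+* ℂ) (hτ : τ C = C) (hr : ∀ r : ℝ, τ r = r)
    {Y Z : YoungDiagram} (R : YoungRep n Y) (S : YoungRep n Z) (i j : Fin n → ℤ)
    (hi : Function.Injective i) (hj : Function.Injective j)
    (hi' : ∀ a, 0 < i a) (hj' : ∀ a, 0 ≤ j a) (α β : Fin R.d) (μ ν : Fin S.d) :
    vermaForm C τ hτ (youngKet C i j R α β) (youngKet C i j S μ ν)
      = (∑ σ, youngCoeff R α β σ * (S.D σ μ ν : ℂ))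
        * ((S.d : ℂ) / (n.factorial : ℂ) * contentProd C Y) := by
  have hτc : ∀ σ, τ (youngCoeff R α β σ) = youngCoeff R α β σ := fun σ => by
    rw [youngCoeff, map_mul, map_div₀, map_natCast, map_natCast, hr]
  -- Substituting `ρσ` for `σ` and factoring `D(ρσ) = D(ρ)D(σ)` exposes the Gram operator, a scalar
  -- by `YoungRep.sum_sign_pow_cycleCount`.
  have hgram : ∀ ρ, ∑ σ, youngCoeff R α β σ
      * (((Perm.sign (ρ⁻¹ * σ) : ℤ) : ℂ) * C ^ cycleCount n (ρ⁻¹ * σ))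
      = youngCoeff R α β ρ * contentProd C Y := by
    intro ρ
    rw [← Equiv.sum_comp (Equiv.mulLeft ρ)]
    simp only [Equiv.coe_mulLeft, inv_mul_cancel_left, youngCoeff, map_mul, Matrix.mul_apply]
    push_cast
    simp only [Finset.mul_sum, Finset.sum_mul]
    rw [Finset.sum_comm, Finset.sum_eq_single β]
    · have := R.sum_sign_pow_cycleCount C β β
      rw [if_pos rfl] at this
      rw [← this, Finset.mul_sum]
      exact Finset.sum_congr rfl fun σ _ => by ring
    · intro κ _ hκ
      have := R.sum_sign_pow_cycleCount C κ β
      rw [if_neg hκ] at this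
      rw [← mul_zero ((R.d : ℂ) / (n.factorial : ℂ) * (R.D ρ α κ : ℂ)), ← this, Finset.mul_sum]
      exact Finset.sum_congr rfl fun σ _ => by ring
    · simp
  rw [youngKet_eq, youngKet_eq, Fintype.linearCombination_apply, Fintype.linearCombination_apply,
    map_sum, map_sum, Finset.sum_mul]
  refine Finset.sum_congr rfl fun ρ _ => ?_
  rw [map_smul, LinearMap.sum_apply, smul_eq_mul]
  have : ∀ σ, vermaForm C τ hτ (youngCoeff R α β σ • permState C i j σ) (permState C i j ρ)
      = youngCoeff R α β σ
        * (((Perm.sign (ρ⁻¹ * σ) : ℤ) : ℂ) * C ^ cycleCount n (ρ⁻¹ * σ)) := fun σ => by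
    rw [LinearMap.map_smulₛₗ, LinearMap.smul_apply, hτc, smul_eq_mul,
      vermaForm_permState C τ hτ i j hi hj hi' hj']
  rw [Finset.sum_congr rfl fun σ _ => this σ, hgram, youngCoeff]
  ring

end YoungBasis

/-! ## The character formula -/

section CharacterFormula

open Equiv

variable {n : ℕ}

/-- The number of permutations of cycle type `k`. -/
lemma card_filter_partition_eq (k : n.Partition) (ρ : Perm (Fin n))
    (hρ : ρ.partition.parts = k.parts) :
    ((Finset.univ.filter fun σ : Perm (Fin n) => σ.partition.parts = k.parts).card : ℂ)
      = classSize k := by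
  set m := ρ.cycleType with hm
  set N := n - m.sum with hN
  -- A cycle type omits the fixed points, a partition lists them as parts 1; the factor `N!` in the
  -- counting formula is the contribution of these parts.
  have hparts : k.parts = m + Multiset.replicate N 1 := by
    rw [← hρ, Perm.parts_partition, Fintype.card_fin, hN, hm, Perm.sum_cycleType]
  have hmle : m.sum ≤ n := by
    rw [hm, Perm.sum_cycleType]
    exact (Finset.card_le_univ _).trans (Fintype.card_fin n).le
  have hm2 : ∀ a ∈ m, 2 ≤ a := fun a => Perm.two_le_of_mem_cycleType
  have hfilter : (Finset.univ.filter fun σ : Perm (Fin n) => σ.partition.parts = k.parts)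
      = Finset.univ.filter fun σ : Perm (Fin n) => σ.cycleType = m := by
    refine Finset.filter_congr fun σ _ => ?_
    rw [← hρ, ← Nat.Partition.ext_iff, ← Perm.partition_eq_of_isConj,
      Perm.isConj_iff_cycleType_eq]
  have hcard := Perm.card_of_cycleType_mul_eq (Fin n) m
  rw [if_pos ⟨by rwa [Fintype.card_fin], hm2⟩, Fintype.card_fin, ← hN] at hcard
  have hsub : k.parts.toFinset ⊆ Finset.Icc 1 n := by
    intro a ha
    rw [Multiset.mem_toFinset] at ha
    rw [Finset.mem_Icc]
    exact ⟨k.parts_pos ha, k.parts_sum ▸ Multiset.le_sum_of_mem ha⟩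
  have h1 : ∏ j ∈ Finset.Icc 1 n, j ^ k.parts.count j = m.prod := by
    rw [← Finset.prod_multiset_count_of_subset _ _ hsub, hparts, Multiset.prod_add,
      Multiset.prod_replicate, one_pow, mul_one]
  have hcount : ∀ j, (k.parts.count j).factorial
      = (m.count j).factorial * if j = 1 then N.factorial else 1 := by
    intro j
    rw [hparts, Multiset.count_add, Multiset.count_replicate]
    by_cases hj : j = 1
    · have : m.count 1 = 0 := Multiset.count_eq_zero.2 fun h => by
        have := hm2 1 h; omega
      subst hj
      simp [this]
    · simp [hj, Ne.symm hj]
  have h2 : ∏ j ∈ Finset.Icc 1 n, (k.parts.count j).factorial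
      = N.factorial * ∏ j ∈ m.toFinset, (m.count j).factorial := by
    simp only [hcount, Finset.prod_mul_distrib]
    rw [mul_comm]
    congr 1
    · rw [Finset.prod_ite_eq']
      split_ifs with h
      · rfl
      -- The product has no factor at `j = 1` only if it is empty.
      · have hn : n = 0 := by rw [Finset.mem_Icc] at h; omega
        have : N = 0 := by omega
        rw [this, Nat.factorial_zero]
    · symm
      refine Finset.prod_subset (fun a ha => hsub ?_) fun a _ ha => ?_
      · rw [Multiset.mem_toFinset] at ha ⊢
        rw [hparts]
        exact Multiset.mem_add.2 (Or.inl ha)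
      · rw [Multiset.count_eq_zero.2 fun h => ha (Multiset.mem_toFinset.2 h), Nat.factorial_zero]
  have h3 : ∏ j ∈ Finset.Icc 1 n, (j ^ k.parts.count j * (k.parts.count j).factorial)
      = N.factorial * m.prod * ∏ j ∈ m.toFinset, (m.count j).factorial := by
    rw [Finset.prod_mul_distrib, h1, h2]; ring
  rw [← h3] at hcard
  have h4 : (∏ j ∈ Finset.Icc 1 n,
      ((j : ℂ) ^ k.parts.count j * ((k.parts.count j).factorial : ℂ))) ≠ 0 := by
    refine Finset.prod_ne_zero_iff.2 fun j hj => mul_ne_zero (pow_ne_zero _ ?_) ?_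
    · rw [Finset.mem_Icc] at hj
      exact Nat.cast_ne_zero.2 (by omega)
    · exact Nat.cast_ne_zero.2 (Nat.factorial_ne_zero _)
  rw [classSize, eq_div_iff h4, hfilter, ← hcard]
  push_cast
  rfl

/-- The partition of `n` given by the cycle lengths of a permutation. -/
def permPartition (σ : Perm (Fin n)) : n.Partition where
  parts := σ.partition.parts
  parts_pos := σ.partition.parts_pos
  parts_sum := by rw [σ.partition.parts_sum, Fintype.card_fin]

/-- This is the trace of the Gram operator on the representation, with the permutations grouped by
cycle type. -/
theorem YoungRep.character_formula {Y : YoungDiagram} (R : YoungRep n Y) (C : ℂ)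
    (s : n.Partition → Perm (Fin n)) (hs : ∀ k, (s k).partition.parts = k.parts) :
    (-1 : ℂ) ^ n / (n.factorial : ℂ) *
        ∑ k : n.Partition, (-C) ^ (Multiset.card k.parts) * classSize k *
          ((R.D (s k)).trace : ℂ)
      = (R.d : ℂ) / (n.factorial : ℂ) * contentProd C Y := by
  have htr : ∑ σ : Perm (Fin n), ((Perm.sign σ : ℤ) : ℂ) * C ^ cycleCount n σ
      * ((R.D σ).trace : ℂ) = (R.d : ℂ) * contentProd C Y := by
    simp only [Matrix.trace, Matrix.diag_apply, Complex.ofReal_sum, Finset.mul_sum]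
    rw [Finset.sum_comm]
    simp [R.sum_sign_pow_cycleCount C]
  have hterm : ∀ σ : Perm (Fin n), ((Perm.sign σ : ℤ) : ℂ) * C ^ cycleCount n σ
      * ((R.D σ).trace : ℂ) = (-1) ^ n * ((-C) ^ (Multiset.card (permPartition σ).parts)
        * ((R.D (s (permPartition σ))).trace : ℂ)) := by
    intro σ
    have h1 := sign_mul_pow_cycleCount C σ
    have h2 : cycleCount n σ = Multiset.card (permPartition σ).parts := by
      have := cycleCount_card_eq_card_parts σ
      -- The type of `σ.partition` depends on the cardinality about to be rewritten, so its parts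
      -- are generalized first.
      generalize hp : σ.partition.parts = p at this
      rw [Fintype.card_fin] at this
      rw [this, ← hp, permPartition]
    rw [Fintype.card_fin] at h1
    have h3 : IsConj σ (s (permPartition σ)) := by
      rw [Perm.partition_eq_of_isConj]
      exact Nat.Partition.ext (hs (permPartition σ)).symm
    rw [h1, h2, R.trace_eq_of_isConj h3, mul_assoc]
  rw [div_mul_eq_mul_div, div_mul_eq_mul_div]
  congr 1
  rw [← htr, Finset.sum_congr rfl fun σ _ => hterm σ, ← Finset.mul_sum]
  congr 1
  rw [← Finset.sum_fiberwise Finset.univ (permPartition (n := n))]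
  refine Finset.sum_congr rfl fun k _ => ?_
  have hf : (Finset.univ.filter fun σ : Perm (Fin n) => permPartition σ = k)
      = Finset.univ.filter fun σ : Perm (Fin n) => σ.partition.parts = k.parts :=
    Finset.filter_congr fun σ _ => Nat.Partition.ext_iff
  rw [← card_filter_partition_eq k (s k) (hs k), ← hf, Finset.sum_congr rfl (g := fun _ =>
    (-C) ^ (Multiset.card k.parts) * ((R.D (s k)).trace : ℂ)) fun σ hσ => by
      rw [(Finset.mem_filter.1 hσ).2], Finset.sum_const, nsmul_eq_mul]
  ring

end CharacterFormula

theorem theorem2 (C : ℂ) (τ : ℂ →+* ℂ)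
    (hτ : τ = RingHom.id ℂ ∨ (τ = starRingEnd ℂ ∧ τ C = C)) :
    (∃! B : VermaModule C →ₛₗ[τ] VermaModule C →ₗ[ℂ] ℂ, IsInnerForm C τ B) ∧
    ∀ (n : ℕ) (R : ∀ Y : DiagramOfSize n, YoungRep n Y.1),
      (∀ i j : Fin n → ℤ, Function.Injective i → Function.Injective j →
        (∀ a, 0 < i a) → (∀ a, 0 ≤ j a) →
        LinearIndependent ℂ
          (fun x : Σ Y : DiagramOfSize n, Fin (R Y).d × Fin (R Y).d =>
            youngKet C i j (R x.1) x.2.1 x.2.2) ∧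
        Submodule.span ℂ (Set.range
          (fun x : Σ Y : DiagramOfSize n, Fin (R Y).d × Fin (R Y).d =>
            youngKet C i j (R x.1) x.2.1 x.2.2)) =
          Submodule.span ℂ (Set.range (permState C i j)) ∧
        ∀ B : VermaModule C →ₛₗ[τ] VermaModule C →ₗ[ℂ] ℂ, IsInnerForm C τ B →
          (∀ (Y : DiagramOfSize n) (α β : Fin (R Y).d),
            B (youngKet C i j (R Y) α β) (youngKet C i j (R Y) α β) =
              ((R Y).d : ℂ) / (n.factorial : ℂ) * contentProd C Y.1) ∧
          ∀ x y : Σ Y : DiagramOfSize n, Fin (R Y).d × Fin (R Y).d, x ≠ y →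
            B (youngKet C i j (R x.1) x.2.1 x.2.2)
              (youngKet C i j (R y.1) y.2.1 y.2.2) = 0) ∧
      ∀ (Y : DiagramOfSize n) (s : n.Partition → Equiv.Perm (Fin n)),
        (∀ k, (s k).partition.parts = k.parts) →
        (-1 : ℂ) ^ n / (n.factorial : ℂ) *
            ∑ k : n.Partition, (-C) ^ (Multiset.card k.parts) * classSize k *
              (((R Y).D (s k)).trace : ℂ) =
          ((R Y).d : ℂ) / (n.factorial : ℂ) * contentProd C Y.1 := by
  have hC : τ C = C := by
    rcases hτ with rfl | h
    · rfl
    · exact h.2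
  have hr : ∀ r : ℝ, τ r = r := by
    rcases hτ with rfl | ⟨rfl, -⟩
    · exact fun _ => rfl
    · exact Complex.conj_ofReal
  refine ⟨⟨vermaForm C τ hC, vermaForm_isInnerForm C τ hC,
    fun B hB => hB.unique (vermaForm_isInnerForm C τ hC)⟩, fun n R => ⟨?_, ?_⟩⟩
  · intro i j hi hj hi' hj'
    refine ⟨youngKet_linearIndependent C R i j hi hj hi' hj', span_youngKet C R i j,
      fun B hB => ?_⟩
    classical
    have hform : ∀ x y : Σ Y : DiagramOfSize n, Fin (R Y).d × Fin (R Y).d,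
        B (youngKet C i j (R x.1) x.2.1 x.2.2) (youngKet C i j (R y.1) y.2.1 y.2.2)
          = (if x = y then 1 else 0)
            * (((R y.1).d : ℂ) / (n.factorial : ℂ) * contentProd C x.1.1) := by
      intro x y
      rw [hB.unique (vermaForm_isInnerForm C τ hC),
        vermaForm_youngKet C τ hC hr _ _ i j hi hj hi' hj', sum_youngCoeff_mul]
    refine ⟨fun Y α β => ?_, fun x y hxy => ?_⟩
    · have := hform ⟨Y, α, β⟩ ⟨Y, α, β⟩
      rwa [if_pos rfl, one_mul] at this
    · rw [hform, if_neg hxy, zero_mul]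
  · exact fun Y s hs => (R Y).character_formula C s hs
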